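/- Let $\mathbb{T}^2=(\mathbb{R}/\mathbb{Z})^2$ carry the flat (Lebesgue) measure. For a bounded real vector field $v$ on $\mathbb{T}^2$ let $\dot{\mathcal I}(v)$ be the set of all complex-valued $\phi\in H^1(\mathbb{T}^2)$ with $\int_{\mathbb{T}^2}\phi\,dx\,dy=0$ such that $v\cdot\nabla\phi=i\mu\phi$ almost everywhere for some $\mu\in\mathbb{R}$ ($\nabla\phi$ is the weak gradient), and put $$r(v)=\inf_{0\ne\phi\in\dot{\mathcal I}(v)}\frac{\int_{\mathbb{T}^2}|\nabla\phi|^2\,dx\,dy}{\int_{\mathbb{T}^2}|\phi|^2\,dx\,dy}\in[0,\infty],\qquad \inf\varnothing=\infty.$$ For each integer $n\ge 1$ let $v_n=\nabla^{\perp}\Psi_n=(-\partial_y\Psi_n,\partial_x\Psi_n)$ be the cellular flow with stream function $\Psi_n(x,y)=\sin(2\pi n x)\cos(2\pi n y)$. Then there is a constant $\delta>0$, independent of $n$, such that for every $n\ge 1$ $$r(v_n)\ge\delta n^2;$$ equivalently, $\int_{\mathbb{T}^2}|\nabla\phi|^2\,dx\,dy\ge\delta n^2\int_{\mathbb{T}^2}|\phi|^2\,dx\,dy$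 for every $\phi\in\dot{\mathcal I}(v_n)$. -/

import Mathlib

open MeasureTheory
open scoped ContDiff ENNReal

namespace CellularFlow

/-- The flat torus `𝕋² = (ℝ/ℤ)²`; its `volume` is the flat measure of total mass one. -/
abbrev T2 : Type := UnitAddTorus (Fin 2)

/-- The classical `i`-th partial derivative of a function on the torus. -/
noncomputable def partialDeriv {E : Type*} [NormedAddCommGroup E] [NormedSpace ℝ E]
    (i : Fin 2) (f : T2 → E) (p : T2) : E :=
  deriv (fun t : ℝ => f (p + Pi.single i (t : UnitAddCircle))) 0

/-- Smooth complex functions on the torus: those whose `ℤ²`-periodic lift to `ℝ²` is `C^∞`. -/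
def IsSmooth (ψ : T2 → ℂ) : Prop :=
  ContDiff ℝ ∞ fun x : Fin 2 → ℝ => ψ fun i => (x i : UnitAddCircle)

/-- `G` is the weak (distributional) gradient of `φ`. -/
def HasWeakGradient (φ : T2 → ℂ) (G : T2 → Fin 2 → ℂ) : Prop :=
  ∀ (i : Fin 2) (ψ : T2 → ℂ), IsSmooth ψ →
    ∫ p, φ p * partialDeriv i ψ p = -∫ p, G p i * ψ p

/-- `φ ∈ H¹(𝕋²; ℂ)`: `φ` is square integrable with a square integrable weak gradient. -/
def MemH1 (φ : T2 → ℂ) : Prop :=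
  MemLp φ 2 volume ∧
    ∃ G : T2 → Fin 2 → ℂ, (∀ i, MemLp (fun p => G p i) 2 volume) ∧ HasWeakGradient φ G

open Classical in
/-- The weak gradient `∇φ` of `φ ∈ H¹` (unique up to null sets; by convention `0` off `H¹`). -/
noncomputable def weakGrad (φ : T2 → ℂ) : T2 → Fin 2 → ℂ :=
  if h : MemH1 φ then h.2.choose else 0

/-- The mean-zero `H¹` eigenfunctions of `v · ∇`, with eigenvalue `iμ`, `μ ∈ ℝ`
(together with the zero function). -/
def eigenfunctions (v : T2 → Fin 2 → ℝ) : Set (T2 → ℂ) :=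
  {φ | MemH1 φ ∧ ∫ p, φ p = 0 ∧
    ∃ μ : ℝ, ∀ᵐ p, ∑ i, (v p i : ℂ) * weakGrad φ p i = Complex.I * (μ : ℂ) * φ p}

/-- `∫ |φ|²`. -/
noncomputable def l2NormSq (φ : T2 → ℂ) : ℝ :=
  ∫ p, ‖φ p‖ ^ 2

/-- The Dirichlet energy `∫ |∇φ|²`. -/
noncomputable def dirichletEnergy (φ : T2 → ℂ) : ℝ :=
  ∫ p, ∑ i, ‖weakGrad φ p i‖ ^ 2

/-- `r(v)`: the infimum of the Rayleigh quotient over the nonzero mean-zero `H¹` eigenfunctions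
of `v · ∇`; it is `∞` when there are none. -/
noncomputable def rate (v : T2 → Fin 2 → ℝ) : ℝ≥0∞ :=
  ⨅ φ ∈ {φ | φ ∈ eigenfunctions v ∧ ¬ φ =ᵐ[volume] 0},
    ENNReal.ofReal (dirichletEnergy φ / l2NormSq φ)

theorem periodic_sin (n : ℕ) :
    Function.Periodic (fun x : ℝ => Real.sin (2 * Real.pi * n * x)) 1 := fun x => by
  have h : 2 * Real.pi * n * (x + 1) = 2 * Real.pi * n * x + n * (2 * Real.pi) := by ring
  simp only [h, Real.sin_add_nat_mul_two_pi]

theorem periodic_cos (n : ℕ) :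
    Function.Periodic (fun x : ℝ => Real.cos (2 * Real.pi * n * x)) 1 := fun x => by
  have h : 2 * Real.pi * n * (x + 1) = 2 * Real.pi * n * x + n * (2 * Real.pi) := by ring
  simp only [h, Real.cos_add_nat_mul_two_pi]

/-- The stream function `Ψ_n(x, y) = sin(2πnx) cos(2πny)` on the torus. -/
noncomputable def stream (n : ℕ) (p : T2) : ℝ :=
  (periodic_sin n).lift (p 0) * (periodic_cos n).lift (p 1)

/-- `∇^⊥ Ψ = (-∂_y Ψ, ∂_x Ψ)`. -/
noncomputable def gradPerp (Ψ : T2 → ℝ) (p : T2) : Fin 2 → ℝ :=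
  ![-partialDeriv 1 Ψ p, partialDeriv 0 Ψ p]

/-- The cellular flow `v_n = ∇^⊥ Ψ_n`. -/
noncomputable def cellularFlow (n : ℕ) : T2 → Fin 2 → ℝ :=
  gradPerp (stream n)

end CellularFlow

/-! Dilating by 2n and shifting by half a cell turns Ψ_n into ψ = sin(πx) sin(πy), whose cells are
unit squares, and the torus into a box of 4n² cells. In two dimensions this leaves the Dirichlet
energy unchanged and multiplies ∫|φ|² by 4n², so it suffices to prove a Poincaré inequality on the
box whose constant does not depend on the number of cells.

On one cell the energy controls the deviation from an edge average (`integral_sub_hEdge_sq_le`);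
what is needed is a single constant serving all cells. If the eigenvalue is nonzero, integrating the
equation over a cell, whose boundary carries no flux, shows that the cell mean vanishes
(`integral_sq_le_of_ne_zero`). If it is zero, φ is constant along streamlines; those close to the
boundary of a cell follow all four edges, so adjacent edges have equal averages
(`norm_sub_edge_sq_le`). Neighbouring cells share edges, so all edge averages in the box agree.

These arguments are run for smooth functions that satisfy the equation only approximately: the
constant is 4 + η, and the squared L² defect enters with a factor B independent of the function
(`exists_boxIntegral_sub_sq_le`). For the Fourier partial sums of an eigenfunction the defect tends
to 0, because v_n is bounded and the sums converge in H¹. Since B depends on η, the partial sums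
pass to the limit first, and then η → 0. -/

namespace CellularFlow

open Set Filter Topology

/-! ### Integration over unit cells -/

/-- Lebesgue measure on the unit square `(a, a + 1] × (b, b + 1]`. -/
noncomputable def cell (a b : ℝ) : Measure (ℝ × ℝ) :=
  (volume.restrict (Ioc a (a + 1))).prod (volume.restrict (Ioc b (b + 1)))

instance isProbabilityMeasure_restrict_Ioc (a : ℝ) :
    IsProbabilityMeasure (volume.restrict (Ioc a (a + 1)) : Measure ℝ) :=
  ⟨by simp⟩

instance isProbabilityMeasure_cell (a b : ℝ) : IsProbabilityMeasure (cell a b) := by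
  unfold cell; infer_instance

theorem cell_eq_restrict (a b : ℝ) :
    cell a b = volume.restrict (Ioc a (a + 1) ×ˢ Ioc b (b + 1)) := by
  rw [cell, Measure.prod_restrict, Measure.volume_eq_prod]

theorem ae_cell_mem (a b : ℝ) :
    ∀ᵐ z ∂cell a b, z.1 ∈ Ioc a (a + 1) ∧ z.2 ∈ Ioc b (b + 1) := by
  rw [cell_eq_restrict]
  exact ae_restrict_mem (measurableSet_Ioc.prod measurableSet_Ioc)

section

variable {E : Type*} [NormedAddCommGroup E]

theorem integrable_cell {g : ℝ × ℝ → E} (hg : Continuous g) (a b : ℝ) :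
    Integrable g (cell a b) := by
  rw [cell_eq_restrict]
  have h : IntegrableOn g (Icc a (a + 1) ×ˢ Icc b (b + 1)) :=
    hg.continuousOn.integrableOn_compact (isCompact_Icc.prod isCompact_Icc)
  exact h.mono_set (prod_mono Ioc_subset_Icc_self Ioc_subset_Icc_self)

variable [NormedSpace ℝ E]

theorem integral_cell {g : ℝ × ℝ → E} (hg : Continuous g) (a b : ℝ) :
    ∫ z, g z ∂cell a b = ∫ x in a..a + 1, ∫ y in b..b + 1, g (x, y) := by
  rw [cell, integral_prod _ (by exact integrable_cell hg a b),
    intervalIntegral.integral_of_le (by linarith)]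
  refine integral_congr_ae (Eventually.of_forall fun x => ?_)
  simp only
  rw [intervalIntegral.integral_of_le (by linarith)]

theorem integral_cell_symm {g : ℝ × ℝ → E} (hg : Continuous g) (a b : ℝ) :
    ∫ z, g z ∂cell a b = ∫ y in b..b + 1, ∫ x in a..a + 1, g (x, y) := by
  rw [cell, integral_prod_symm _ (by exact integrable_cell hg a b),
    intervalIntegral.integral_of_le (by linarith)]
  refine integral_congr_ae (Eventually.of_forall fun x => ?_)
  simp only
  rw [intervalIntegral.integral_of_le (by linarith)]

end

/-! ### Flux identities and edge averages -/

/-- `Fx`, `Fy` and `Fxy` are the continuous partial derivatives of `F`. -/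
structure HasPartials (F Fx Fy Fxy : ℝ × ℝ → ℂ) : Prop where
  dx : ∀ x y, HasDerivAt (fun s : ℝ => F (s, y)) (Fx (x, y)) x
  dy : ∀ x y, HasDerivAt (fun t : ℝ => F (x, t)) (Fy (x, y)) y
  dxy : ∀ x y, HasDerivAt (fun t : ℝ => Fx (x, t)) (Fxy (x, y)) y
  dyx : ∀ x y, HasDerivAt (fun s : ℝ => Fy (s, y)) (Fxy (x, y)) x
  cont : Continuous F
  cont_x : Continuous Fx
  cont_y : Continuous Fy
  cont_xy : Continuous Fxy

theorem integral_deriv_mul_complex {u u' : ℝ → ℝ} {v v' : ℝ → ℂ}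
    (hu : ∀ x, HasDerivAt u (u' x) x) (hv : ∀ x, HasDerivAt v (v' x) x)
    (cu : Continuous u') (cv : Continuous v') (a b : ℝ) :
    ∫ x in a..b, (u' x : ℂ) * v x
      = (u b : ℂ) * v b - (u a : ℂ) * v a - ∫ x in a..b, (u x : ℂ) * v' x := by
  have h := intervalIntegral.integral_mul_deriv_eq_deriv_mul (a := a) (b := b)
    (u := fun x => (u x : ℂ)) (u' := fun x => (u' x : ℂ)) (v := v) (v' := v')
    (fun x _ => (hu x).ofReal_comp) (fun x _ => hv x)
    (Continuous.intervalIntegrable (by fun_prop) _ _) (cv.intervalIntegrable _ _)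
  rw [h]; ring

/-- A flux `∇^⊥p · ∇F` through a square on whose boundary `p` vanishes is zero. -/
theorem integral_perp_eq_zero {F Fx Fy Fxy : ℝ × ℝ → ℂ} (hF : HasPartials F Fx Fy Fxy)
    {p px py : ℝ × ℝ → ℝ}
    (hpx : ∀ x y, HasDerivAt (fun s : ℝ => p (s, y)) (px (x, y)) x)
    (hpy : ∀ x y, HasDerivAt (fun t : ℝ => p (x, t)) (py (x, y)) y)
    (cp : Continuous p) (cpx : Continuous px) (cpy : Continuous py) {a b : ℝ}
    (h0 : ∀ y, p (a, y) = 0) (h1 : ∀ y, p (a + 1, y) = 0)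
    (h2 : ∀ x, p (x, b) = 0) (h3 : ∀ x, p (x, b + 1) = 0) :
    ∫ z, ((px z : ℂ) * Fy z - (py z : ℂ) * Fx z) ∂cell a b = 0 := by
  have cX := hF.cont_x
  have cY := hF.cont_y
  have cXY := hF.cont_xy
  -- Integrating by parts in x here and in y below turns both terms into the same integral of p
  -- against the mixed derivative.
  have e1 : ∫ z, (px z : ℂ) * Fy z ∂cell a b = -∫ z, (p z : ℂ) * Fxy z ∂cell a b := by
    rw [integral_cell_symm (by fun_prop), integral_cell_symm (by fun_prop),
      ← intervalIntegral.integral_neg]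
    refine intervalIntegral.integral_congr fun y _ => ?_
    have := integral_deriv_mul_complex (fun x => hpx x y) (fun x => hF.dyx x y)
      (by fun_prop) (by fun_prop) a (a + 1)
    simpa [h0, h1] using this
  have e2 : ∫ z, (py z : ℂ) * Fx z ∂cell a b = -∫ z, (p z : ℂ) * Fxy z ∂cell a b := by
    rw [integral_cell (by fun_prop), integral_cell (by fun_prop),
      ← intervalIntegral.integral_neg]
    refine intervalIntegral.integral_congr fun x _ => ?_
    have := integral_deriv_mul_complex (fun y => hpy x y) (fun y => hF.dxy x y)
      (by fun_prop) (by fun_prop) b (b + 1)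
    simpa [h2, h3] using this
  rw [integral_sub (integrable_cell (by fun_prop) _ _) (integrable_cell (by fun_prop) _ _),
    e1, e2, sub_self]

/-- `s₀` and `s₁` are the two endpoints of `[a, a + 1]`, in either order. -/
def Endpoints (a s₀ s₁ : ℝ) : Prop :=
  s₀ = a ∧ s₁ = a + 1 ∨ s₀ = a + 1 ∧ s₁ = a

theorem Endpoints.abs_sub_le {a s₀ s₁ x : ℝ} (h : Endpoints a s₀ s₁) (hx : x ∈ Ioc a (a + 1)) :
    |x - s₀| ≤ 1 := by
  obtain ⟨h1, h2⟩ := hx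
  rcases h with ⟨rfl, -⟩ | ⟨rfl, -⟩ <;> rw [abs_le] <;> constructor <;> linarith

/-- The weight vanishes at s₀ and is 1 or -1 at s₁ according to whether s₁ is the upper or lower
limit, so the boundary term is v s₁ in both orientations. -/
theorem integral_sub_mul_deriv {v v' : ℝ → ℂ} (hv : ∀ x, HasDerivAt v (v' x) x)
    (cv : Continuous v') {a s₀ s₁ : ℝ} (h : Endpoints a s₀ s₁) :
    ∫ x in a..a + 1, ((x - s₀ : ℝ) : ℂ) * v' x = v s₁ - ∫ x in a..a + 1, v x := by
  have := integral_deriv_mul_complex (u := fun x => x - s₀) (u' := fun _ => 1)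
    (fun x => (hasDerivAt_id x).sub_const s₀) hv continuous_const cv a (a + 1)
  simp only [Complex.ofReal_one, one_mul] at this
  rw [this]
  rcases h with ⟨rfl, rfl⟩ | ⟨rfl, rfl⟩ <;> simp

/-- The average of `F` over the horizontal unit segment starting at `(a, y)`. -/
noncomputable def hEdge (F : ℝ × ℝ → ℂ) (a y : ℝ) : ℂ := ∫ x in a..a + 1, F (x, y)

/-- The average of `F` over the vertical unit segment starting at `(x, b)`. -/
noncomputable def vEdge (F : ℝ × ℝ → ℂ) (x b : ℝ) : ℂ := ∫ y in b..b + 1, F (x, y)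

/-- The integrand is ∇^⊥P · ∇F with P = (x - x₀)(y - y₀). As P vanishes on the two edges through the
corner (x₀, y₀), only the opposite two edges contribute; the cell integrals of F cancel. -/
theorem integral_corner_eq {F Fx Fy Fxy : ℝ × ℝ → ℂ} (hF : HasPartials F Fx Fy Fxy)
    {a b x₀ x₁ y₀ y₁ : ℝ} (hx : Endpoints a x₀ x₁) (hy : Endpoints b y₀ y₁) :
    ∫ z, (((z.2 - y₀ : ℝ) : ℂ) * Fy z - ((z.1 - x₀ : ℝ) : ℂ) * Fx z) ∂cell a b
      = hEdge F a y₁ - vEdge F x₁ b := by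
  have cF := hF.cont
  have cX := hF.cont_x
  have cY := hF.cont_y
  have e1 : ∫ z, ((z.2 - y₀ : ℝ) : ℂ) * Fy z ∂cell a b
      = hEdge F a y₁ - ∫ z, F z ∂cell a b := by
    rw [integral_cell (by fun_prop), integral_cell cF, hEdge, ← intervalIntegral.integral_sub]
    · refine intervalIntegral.integral_congr fun x _ => ?_
      exact integral_sub_mul_deriv (fun y => hF.dy x y) (by fun_prop) hy
    · exact Continuous.intervalIntegrable (by fun_prop) _ _
    · exact Continuous.intervalIntegrable (by fun_prop) _ _
  have e2 : ∫ z, ((z.1 - x₀ : ℝ) : ℂ) * Fx z ∂cell a b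
      = vEdge F x₁ b - ∫ z, F z ∂cell a b := by
    rw [integral_cell_symm (by fun_prop), integral_cell_symm cF, vEdge,
      ← intervalIntegral.integral_sub]
    · refine intervalIntegral.integral_congr fun y _ => ?_
      exact integral_sub_mul_deriv (fun x => hF.dx x y) (by fun_prop) hx
    · exact Continuous.intervalIntegrable (by fun_prop) _ _
    · exact Continuous.intervalIntegrable (by fun_prop) _ _
  rw [integral_sub (integrable_cell (by fun_prop) _ _) (integrable_cell (by fun_prop) _ _),
    e1, e2]
  ring

/-- Cauchy–Schwarz, from the discriminant of the nonnegative quadratic t ↦ ∫ (t g + h)². -/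
theorem sq_integral_mul_le {g h : ℝ × ℝ → ℝ} (hg : Continuous g) (hh : Continuous h) (a b : ℝ) :
    (∫ z, g z * h z ∂cell a b) ^ 2 ≤ (∫ z, g z ^ 2 ∂cell a b) * ∫ z, h z ^ 2 ∂cell a b := by
  have key : ∀ t : ℝ, 0 ≤ (∫ z, g z ^ 2 ∂cell a b) * (t * t)
      + (2 * ∫ z, g z * h z ∂cell a b) * t + ∫ z, h z ^ 2 ∂cell a b := by
    intro t
    have e : (∫ z, g z ^ 2 ∂cell a b) * (t * t)
        + (2 * ∫ z, g z * h z ∂cell a b) * t + ∫ z, h z ^ 2 ∂cell a b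
        = ∫ z, (t * g z + h z) ^ 2 ∂cell a b := by
      rw [← integral_mul_const, ← integral_const_mul, ← integral_mul_const, ← integral_add,
        ← integral_add]
      · exact integral_congr_ae (Eventually.of_forall fun z => by simp only; ring)
      all_goals exact integrable_cell (by fun_prop) _ _
    rw [e]
    exact integral_nonneg fun z => sq_nonneg _
  have := discrim_le_zero key
  rw [discrim] at this
  nlinarith

theorem sq_integral_le {h : ℝ × ℝ → ℝ} (hh : Continuous h) (a b : ℝ) :
    (∫ z, h z ∂cell a b) ^ 2 ≤ ∫ z, h z ^ 2 ∂cell a b := by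
  simpa using sq_integral_mul_le (g := fun _ => 1) continuous_const hh a b

/-! ### The model stream function and comparison of adjacent edges -/

/-- The stream function `sin(πx) sin(πy)`, whose cells are the unit squares of the lattice. -/
noncomputable def psi (z : ℝ × ℝ) : ℝ := Real.sin (Real.pi * z.1) * Real.sin (Real.pi * z.2)

noncomputable def psiX (z : ℝ × ℝ) : ℝ :=
  Real.pi * Real.cos (Real.pi * z.1) * Real.sin (Real.pi * z.2)

noncomputable def psiY (z : ℝ × ℝ) : ℝ :=
  Real.pi * Real.sin (Real.pi * z.1) * Real.cos (Real.pi * z.2)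

@[fun_prop] theorem continuous_psi : Continuous psi := by unfold psi; fun_prop
@[fun_prop] theorem continuous_psiX : Continuous psiX := by unfold psiX; fun_prop
@[fun_prop] theorem continuous_psiY : Continuous psiY := by unfold psiY; fun_prop

theorem hasDerivAt_psi_fst (x y : ℝ) : HasDerivAt (fun s => psi (s, y)) (psiX (x, y)) x := by
  have h : HasDerivAt (fun s => Real.pi * s) Real.pi x := by
    simpa using (hasDerivAt_id x).const_mul Real.pi
  refine ((h.sin).mul_const (Real.sin (Real.pi * y))).congr_deriv ?_
  unfold psiX; ring

theorem hasDerivAt_psi_snd (x y : ℝ) : HasDerivAt (fun t => psi (x, t)) (psiY (x, y)) y := by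
  have h : HasDerivAt (fun s => Real.pi * s) Real.pi y := by
    simpa using (hasDerivAt_id y).const_mul Real.pi
  refine ((h.sin).const_mul (Real.sin (Real.pi * x))).congr_deriv ?_
  unfold psiY; ring

theorem sin_pi_mul_int (k : ℤ) : Real.sin (Real.pi * k) = 0 := by
  rw [mul_comm]; exact Real.sin_int_mul_pi k

theorem sin_pi_mul_int_add_one (k : ℤ) : Real.sin (Real.pi * ((k : ℝ) + 1)) = 0 := by
  exact_mod_cast sin_pi_mul_int (k + 1)

theorem abs_psi_le (z : ℝ × ℝ) : |psi z| ≤ 1 := by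
  rw [psi, abs_mul]
  exact mul_le_one₀ (Real.abs_sin_le_one _) (abs_nonneg _) (Real.abs_sin_le_one _)

theorem one_sub_psi_sq_mem (z : ℝ × ℝ) : 1 - psi z ^ 2 ∈ Icc (0 : ℝ) 1 := by
  have := abs_psi_le z
  have h2 : psi z ^ 2 ≤ 1 := by rw [← sq_abs]; nlinarith [abs_nonneg (psi z)]
  exact ⟨by linarith, by nlinarith [sq_nonneg (psi z)]⟩

theorem integral_stream_perp_eq_zero {F Fx Fy Fxy : ℝ × ℝ → ℂ} (hF : HasPartials F Fx Fy Fxy)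
    (a b : ℤ) : ∫ z, ((psiX z : ℂ) * Fy z - (psiY z : ℂ) * Fx z) ∂cell a b = 0 := by
  refine integral_perp_eq_zero hF hasDerivAt_psi_fst hasDerivAt_psi_snd continuous_psi
    continuous_psiX continuous_psiY ?_ ?_ ?_ ?_ <;> intro t <;>
    simp [psi, sin_pi_mul_int, sin_pi_mul_int_add_one]

/-- The Dirichlet energy density. -/
noncomputable def energy (Fx Fy : ℝ × ℝ → ℂ) (z : ℝ × ℝ) : ℝ := ‖Fx z‖ ^ 2 + ‖Fy z‖ ^ 2

/-- Averages over two adjacent edges of a cell nearly agree if `∇^⊥ψ · ∇F` is small. -/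
theorem norm_sub_edge_sq_le {F Fx Fy Fxy : ℝ × ℝ → ℂ} (hF : HasPartials F Fx Fy Fxy)
    (m : ℕ) {a b : ℤ} {x₀ x₁ y₀ y₁ : ℝ} (hx : Endpoints a x₀ x₁) (hy : Endpoints b y₀ y₁) :
    ‖hEdge F a y₁ - vEdge F x₁ b‖ ^ 2
      ≤ 4 * (∫ z, ((1 - psi z ^ 2) ^ m) ^ 2 ∂cell a b) * (∫ z, energy Fx Fy z ∂cell a b)
        + 8 * m ^ 2 * ∫ z, ‖(psiX z : ℂ) * Fy z - (psiY z : ℂ) * Fx z‖ ^ 2 ∂cell a b := by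
  have cX := hF.cont_x
  have cY := hF.cont_y
  set V : ℝ × ℝ → ℂ := fun z => ((z.2 - y₀ : ℝ) : ℂ) * Fy z - ((z.1 - x₀ : ℝ) : ℂ) * Fx z with hV
  set W : ℝ × ℝ → ℂ := fun z => (psiX z : ℂ) * Fy z - (psiY z : ℂ) * Fx z with hW
  have cV : Continuous V := by fun_prop
  have cW : Continuous W := by fun_prop
  -- A cutoff with values in [0, 1], equal to 1 where ψ = 0 and concentrating at the cell boundary
  -- as m grows. With P = (x - x₀)(y - y₀), the product P(1 - q) vanishes on all four edges, so its
  -- flux is zero.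
  set q : ℝ × ℝ → ℝ := fun z => (1 - psi z ^ 2) ^ m with hq
  have cq : Continuous q := by fun_prop
  -- Chosen so that P∇(1 - q) = k∇ψ; since q is a function of ψ, this term only sees the derivative
  -- W along the flow.
  set k : ℝ × ℝ → ℝ := fun z =>
    (z.1 - x₀) * (z.2 - y₀) * (m * (1 - psi z ^ 2) ^ (m - 1) * (2 * psi z)) with hk
  have ck : Continuous k := by fun_prop
  have hzero : ∫ z, ((((z.2 - y₀) * (1 - q z) + k z * psiX z : ℝ) : ℂ) * Fy z
      - (((z.1 - x₀) * (1 - q z) + k z * psiY z : ℝ) : ℂ) * Fx z) ∂cell a b = 0 := by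
    have hqx : ∀ x y, HasDerivAt (fun s => 1 - q (s, y))
        (m * (1 - psi (x, y) ^ 2) ^ (m - 1) * (2 * psi (x, y)) * psiX (x, y)) x := by
      intro x y
      have := ((((hasDerivAt_psi_fst x y).pow 2).const_sub 1).pow m).const_sub 1
      refine this.congr_deriv ?_
      simp only [Pi.pow_apply]; push_cast; ring
    have hqy : ∀ x y, HasDerivAt (fun t => 1 - q (x, t))
        (m * (1 - psi (x, y) ^ 2) ^ (m - 1) * (2 * psi (x, y)) * psiY (x, y)) y := by
      intro x y
      have := ((((hasDerivAt_psi_snd x y).pow 2).const_sub 1).pow m).const_sub 1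
      refine this.congr_deriv ?_
      simp only [Pi.pow_apply]; push_cast; ring
    refine integral_perp_eq_zero hF (p := fun z => (z.1 - x₀) * (z.2 - y₀) * (1 - q z))
      ?_ ?_ (by fun_prop) (by fun_prop) (by fun_prop) ?_ ?_ ?_ ?_
    · intro x y
      have := ((((hasDerivAt_id x).sub_const x₀).mul_const (y - y₀))).mul (hqx x y)
      refine this.congr_deriv ?_
      simp only [hk, id]; ring
    · intro x y
      have := ((((hasDerivAt_id y).sub_const y₀).const_mul (x - x₀))).mul (hqy x y)
      refine this.congr_deriv ?_
      simp only [hk, id]; ring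
    all_goals intro t; simp [hq, psi, sin_pi_mul_int, sin_pi_mul_int_add_one]
  -- Subtracting the zero flux of P(1 - q) from that of P leaves V - ((1 - q)V + kW) = qV - kW.
  have hsplit : hEdge F a y₁ - vEdge F x₁ b
      = (∫ z, (q z : ℂ) * V z ∂cell a b) - ∫ z, (k z : ℂ) * W z ∂cell a b := by
    rw [← integral_corner_eq hF hx hy, ← sub_zero (∫ z, _ ∂cell a b), ← hzero, ← integral_sub,
      ← integral_sub]
    · refine integral_congr_ae (Eventually.of_forall fun z => ?_)
      simp only [hV, hW]; push_cast; ring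
    all_goals exact integrable_cell (by fun_prop) _ _
  have b1 : ‖∫ z, (q z : ℂ) * V z ∂cell a b‖ ^ 2
      ≤ (∫ z, q z ^ 2 ∂cell a b) * (2 * ∫ z, energy Fx Fy z ∂cell a b) := by
    have s1 : ‖∫ z, (q z : ℂ) * V z ∂cell a b‖ ≤ ∫ z, q z * (‖Fx z‖ + ‖Fy z‖) ∂cell a b := by
      refine norm_integral_le_of_norm_le (integrable_cell (by fun_prop) _ _) ?_
      filter_upwards [ae_cell_mem a b] with z hz
      have hq0 : 0 ≤ q z := pow_nonneg (one_sub_psi_sq_mem z).1 m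
      rw [norm_mul, Complex.norm_real, Real.norm_of_nonneg hq0]
      refine mul_le_mul_of_nonneg_left ((norm_sub_le _ _).trans ?_) hq0
      rw [norm_mul, norm_mul, Complex.norm_real, Complex.norm_real, Real.norm_eq_abs,
        Real.norm_eq_abs, add_comm]
      exact add_le_add (mul_le_of_le_one_left (norm_nonneg _) (hx.abs_sub_le hz.1))
        (mul_le_of_le_one_left (norm_nonneg _) (hy.abs_sub_le hz.2))
    have s2 : ∫ z, (‖Fx z‖ + ‖Fy z‖) ^ 2 ∂cell a b ≤ 2 * ∫ z, energy Fx Fy z ∂cell a b := by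
      rw [← integral_const_mul]
      refine integral_mono (integrable_cell (by fun_prop) _ _)
        (integrable_cell (by unfold energy; fun_prop) _ _) fun z => ?_
      simp only [energy]
      nlinarith [sq_nonneg (‖Fx z‖ - ‖Fy z‖)]
    calc _ ≤ (∫ z, q z * (‖Fx z‖ + ‖Fy z‖) ∂cell a b) ^ 2 :=
          pow_le_pow_left₀ (norm_nonneg _) s1 2
      _ ≤ _ := sq_integral_mul_le cq (by fun_prop) _ _
      _ ≤ _ := mul_le_mul_of_nonneg_left s2 (integral_nonneg fun z => sq_nonneg _)
  have b2 : ‖∫ z, (k z : ℂ) * W z ∂cell a b‖ ^ 2 ≤ 4 * m ^ 2 * ∫ z, ‖W z‖ ^ 2 ∂cell a b := by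
    have s1 : ‖∫ z, (k z : ℂ) * W z ∂cell a b‖ ≤ 2 * m * ∫ z, ‖W z‖ ∂cell a b := by
      rw [← integral_const_mul]
      refine norm_integral_le_of_norm_le (integrable_cell (by fun_prop) _ _) ?_
      filter_upwards [ae_cell_mem a b] with z hz
      rw [norm_mul, Complex.norm_real, Real.norm_eq_abs]
      refine mul_le_mul_of_nonneg_right ?_ (norm_nonneg _)
      have h1 := hx.abs_sub_le hz.1
      have h2 := hy.abs_sub_le hz.2
      have h3 : |(1 - psi z ^ 2) ^ (m - 1)| ≤ 1 := by
        rw [abs_of_nonneg (pow_nonneg (one_sub_psi_sq_mem z).1 _)]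
        exact pow_le_one₀ (one_sub_psi_sq_mem z).1 (one_sub_psi_sq_mem z).2
      have h4 := abs_psi_le z
      simp only [hk, abs_mul, Nat.abs_cast, abs_two]
      calc |z.1 - x₀| * |z.2 - y₀| * (m * |(1 - psi z ^ 2) ^ (m - 1)| * (2 * |psi z|))
          ≤ 1 * 1 * (m * 1 * (2 * 1)) := by gcongr
        _ = 2 * m := by ring
    calc _ ≤ (2 * m * ∫ z, ‖W z‖ ∂cell a b) ^ 2 := pow_le_pow_left₀ (norm_nonneg _) s1 2
      _ = 4 * m ^ 2 * (∫ z, ‖W z‖ ∂cell a b) ^ 2 := by ring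
      _ ≤ _ := mul_le_mul_of_nonneg_left (sq_integral_le (by fun_prop) _ _) (by positivity)
  have b3 := norm_sub_le (∫ z, (q z : ℂ) * V z ∂cell a b) (∫ z, (k z : ℂ) * W z ∂cell a b)
  rw [hsplit]
  nlinarith [norm_nonneg ((∫ z, (q z : ℂ) * V z ∂cell a b) - ∫ z, (k z : ℂ) * W z ∂cell a b),
    sq_nonneg (‖∫ z, (q z : ℂ) * V z ∂cell a b‖ - ‖∫ z, (k z : ℂ) * W z ∂cell a b‖)]

/-! ### Poincaré inequality on one cell -/

theorem norm_sub_le_integral_norm_deriv {v v' : ℝ → ℂ} (hv : ∀ x, HasDerivAt v (v' x) x)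
    (cv : Continuous v') {a s t : ℝ} (hs : s ∈ Icc a (a + 1)) (ht : t ∈ Icc a (a + 1)) :
    ‖v t - v s‖ ≤ ∫ x in a..a + 1, ‖v' x‖ := by
  rw [← intervalIntegral.integral_eq_sub_of_hasDerivAt (fun x _ => hv x)
    (cv.intervalIntegrable s t)]
  refine intervalIntegral.norm_integral_le_integral_norm_uIoc.trans ?_
  rw [intervalIntegral.integral_of_le (by linarith)]
  refine setIntegral_mono_set ?_ (Eventually.of_forall fun x => norm_nonneg _) ?_
  · exact (cv.norm.integrableOn_Icc).mono_set Ioc_subset_Icc_self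
  · refine LE.le.eventuallyLE ?_
    exact Ioc_subset_Ioc (le_min hs.1 ht.1) (max_le hs.2 ht.2)

theorem sq_intervalIntegral_le {g : ℝ → ℝ} (hg : Continuous g) (a : ℝ) :
    (∫ x in a..a + 1, g x) ^ 2 ≤ ∫ x in a..a + 1, g x ^ 2 := by
  have := sq_integral_le (h := fun z => g z.1) (by fun_prop) a 0
  rw [integral_cell_symm (by fun_prop), integral_cell_symm (by fun_prop)] at this
  simpa using this

/-- A Poincaré inequality on the unit square, relative to the average over the bottom edge. -/
theorem integral_sub_hEdge_sq_le {F Fx Fy Fxy : ℝ × ℝ → ℂ} (hF : HasPartials F Fx Fy Fxy)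
    (a b : ℝ) :
    ∫ z, ‖F z - hEdge F a b‖ ^ 2 ∂cell a b ≤ 2 * ∫ z, energy Fx Fy z ∂cell a b := by
  have cF := hF.cont
  have cX := hF.cont_x
  have cY := hF.cont_y
  have pt : ∀ z : ℝ × ℝ, z.1 ∈ Ioc a (a + 1) ∧ z.2 ∈ Ioc b (b + 1) →
      ‖F z - hEdge F a b‖ ≤ (∫ s in a..a + 1, ‖Fx (s, z.2)‖) + ∫ w, ‖Fy w‖ ∂cell a b := by
    rintro ⟨x, y⟩ ⟨hx, hy⟩
    simp only at hx hy ⊢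
    -- Move horizontally at height y, then vertically down to the bottom edge, averaging over the
    -- abscissa s of the vertical segment.
    have e : F (x, y) - hEdge F a b = (∫ s in a..a + 1, (F (x, y) - F (s, y)))
        + ∫ s in a..a + 1, (F (s, y) - F (s, b)) := by
      rw [← intervalIntegral.integral_add, hEdge]
      · simp only [sub_add_sub_cancel]
        rw [intervalIntegral.integral_sub]
        · simp
        all_goals exact Continuous.intervalIntegrable (by fun_prop) _ _
      all_goals exact Continuous.intervalIntegrable (by fun_prop) _ _
    rw [e]
    refine (norm_add_le _ _).trans (add_le_add ?_ ?_)
    · have := intervalIntegral.norm_integral_le_of_norm_le_const (a := a) (b := a + 1)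
        (f := fun s => F (x, y) - F (s, y)) (C := ∫ s in a..a + 1, ‖Fx (s, y)‖) ?_
      · simpa using this
      · intro s hs
        rw [uIoc_of_le (by linarith)] at hs
        exact norm_sub_le_integral_norm_deriv (fun s => hF.dx s y) (by fun_prop)
          (Ioc_subset_Icc_self hs) (Ioc_subset_Icc_self hx)
    · rw [integral_cell (by fun_prop)]
      refine intervalIntegral.norm_integral_le_of_norm_le (by linarith)
        (Eventually.of_forall fun s hs => ?_)
        (Continuous.intervalIntegrable (by fun_prop) _ _)
      exact norm_sub_le_integral_norm_deriv (fun t => hF.dy s t) (by fun_prop)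
        ⟨le_rfl, by linarith⟩ (Ioc_subset_Icc_self hy)
  have hslice : ∫ z, (∫ s in a..a + 1, ‖Fx (s, z.2)‖ ^ 2) ∂cell a b
      = ∫ z, ‖Fx z‖ ^ 2 ∂cell a b := by
    rw [integral_cell_symm (by fun_prop), integral_cell_symm (by fun_prop)]
    simp
  have hmono : ∫ z, ‖F z - hEdge F a b‖ ^ 2 ∂cell a b
      ≤ ∫ z, (2 * (∫ s in a..a + 1, ‖Fx (s, z.2)‖ ^ 2)
        + 2 * ∫ w, ‖Fy w‖ ^ 2 ∂cell a b) ∂cell a b := by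
    refine integral_mono_ae (integrable_cell (by fun_prop) _ _)
      (integrable_cell (by fun_prop) _ _) ?_
    filter_upwards [ae_cell_mem a b] with z hz
    have h1 := pt z hz
    have h2 := sq_intervalIntegral_le (g := fun s => ‖Fx (s, z.2)‖) (by fun_prop) a
    have h3 := sq_integral_le (h := fun w => ‖Fy w‖) (by fun_prop) a b
    nlinarith [norm_nonneg (F z - hEdge F a b),
      sq_nonneg ((∫ s in a..a + 1, ‖Fx (s, z.2)‖) - ∫ w, ‖Fy w‖ ∂cell a b)]
  refine hmono.trans (le_of_eq ?_)
  unfold energy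
  rw [integral_add, integral_add, integral_const_mul, hslice]
  · simp; ring
  all_goals exact integrable_cell (by fun_prop) _ _

theorem norm_sub_sq_eq (w c : ℂ) :
    ‖w - c‖ ^ 2 = ‖w‖ ^ 2 - 2 * (w * (starRingEnd ℂ) c).re + ‖c‖ ^ 2 := by
  simp only [← Complex.normSq_eq_norm_sq, Complex.normSq_sub]; ring

section

variable {α : Type*} [MeasurableSpace α] {P : Measure α} [IsProbabilityMeasure P] {F : α → ℂ}

/-- The expansion of the mean square deviation of `F` from `c` around the mean of `F`. -/
theorem integral_norm_sub_sq (hF : Integrable F P) (hF2 : Integrable (fun z => ‖F z‖ ^ 2) P)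
    (c : ℂ) : ∫ z, ‖F z - c‖ ^ 2 ∂P
      = ∫ z, ‖F z‖ ^ 2 ∂P - ‖∫ z, F z ∂P‖ ^ 2 + ‖(∫ z, F z ∂P) - c‖ ^ 2 := by
  have hre : ∫ z, (F z * (starRingEnd ℂ) c).re ∂P
      = ((∫ z, F z ∂P) * (starRingEnd ℂ) c).re := by
    rw [← integral_mul_const]
    exact Complex.reCLM.integral_comp_comm (hF.mul_const _)
  have hint : Integrable (fun z => (F z * (starRingEnd ℂ) c).re) P :=
    Complex.reCLM.integrable_comp (hF.mul_const _)
  simp only [norm_sub_sq_eq]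
  rw [integral_add (by exact hF2.sub (hint.const_mul 2)) (integrable_const _),
    integral_sub hF2 (hint.const_mul 2), integral_const_mul, hre]
  simp
  ring

theorem integral_norm_sq_le (hF : Integrable F P) (hF2 : Integrable (fun z => ‖F z‖ ^ 2) P)
    (c : ℂ) : ∫ z, ‖F z‖ ^ 2 ∂P ≤ ∫ z, ‖F z - c‖ ^ 2 ∂P + ‖∫ z, F z ∂P‖ ^ 2 := by
  have := integral_norm_sub_sq hF hF2 c
  nlinarith [sq_nonneg ‖(∫ z, F z ∂P) - c‖]

theorem norm_integral_sq_le (hF : Integrable F P) (hF2 : Integrable (fun z => ‖F z‖ ^ 2) P) :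
    ‖∫ z, F z ∂P‖ ^ 2 ≤ ∫ z, ‖F z‖ ^ 2 ∂P := by
  have h := integral_norm_sub_sq hF hF2 (∫ z, F z ∂P)
  have h0 : 0 ≤ ∫ z, ‖F z - ∫ z, F z ∂P‖ ^ 2 ∂P := integral_nonneg fun z => by positivity
  rw [sub_self, norm_zero] at h
  linarith

end

/-! ### Approximate eigenfunctions on the box -/

/-- The deviation of `F` from being an eigenfunction of `∇^⊥ψ · ∇` with eigenvalue `iκ`. -/
noncomputable def defect (κ : ℝ) (F Fx Fy : ℝ × ℝ → ℂ) (z : ℝ × ℝ) : ℂ :=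
  (psiX z : ℂ) * Fy z - (psiY z : ℂ) * Fx z - Complex.I * (κ : ℂ) * F z

/-- The flux term integrates to zero, so the integral of the defect is -iκ times the cell mean of F.
The mean is thus bounded through the defect, and the fluctuation through the Poincaré inequality. -/
theorem integral_sq_le_of_ne_zero {F Fx Fy Fxy : ℝ × ℝ → ℂ} (hF : HasPartials F Fx Fy Fxy)
    {κ : ℝ} (hκ : κ ≠ 0) (a b : ℤ) :
    ∫ z, ‖F z‖ ^ 2 ∂cell a b ≤ 2 * (∫ z, energy Fx Fy z ∂cell a b)
      + (κ ^ 2)⁻¹ * ∫ z, ‖defect κ F Fx Fy z‖ ^ 2 ∂cell a b := by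
  have cF := hF.cont
  have cX := hF.cont_x
  have cY := hF.cont_y
  have h1 := integral_norm_sq_le (integrable_cell cF a b)
    (integrable_cell (by fun_prop) a b) (hEdge F a b)
  have h2 := integral_sub_hEdge_sq_le hF a b
  have h3 : ∫ z, defect κ F Fx Fy z ∂cell a b = -(Complex.I * κ * ∫ z, F z ∂cell a b) := by
    unfold defect
    rw [integral_sub, integral_stream_perp_eq_zero hF, integral_const_mul, zero_sub]
    all_goals exact integrable_cell (by fun_prop) _ _
  have h4 : κ ^ 2 * ‖∫ z, F z ∂cell a b‖ ^ 2 ≤ ∫ z, ‖defect κ F Fx Fy z‖ ^ 2 ∂cell a b := by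
    have e : κ ^ 2 * ‖∫ z, F z ∂cell a b‖ ^ 2 = ‖∫ z, defect κ F Fx Fy z ∂cell a b‖ ^ 2 := by
      rw [h3, norm_neg, norm_mul, norm_mul, Complex.norm_I, Complex.norm_real, one_mul, mul_pow,
        Real.norm_eq_abs, sq_abs]
    rw [e]
    have cd : Continuous (defect κ F Fx Fy) := by unfold defect; fun_prop
    exact norm_integral_sq_le (integrable_cell cd _ _) (integrable_cell (by fun_prop) _ _)
  have h5 : ‖∫ z, F z ∂cell a b‖ ^ 2
      ≤ (κ ^ 2)⁻¹ * ∫ z, ‖defect κ F Fx Fy z‖ ^ 2 ∂cell a b := by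
    rw [inv_mul_eq_div, le_div_iff₀ (by positivity)]
    linarith
  linarith

/-- Dominated convergence: inside the cell ψ ≠ 0, so the powers of 1 - ψ² < 1 tend to 0. -/
theorem tendsto_integral_cutoff (a b : ℤ) :
    Tendsto (fun m : ℕ => ∫ z, ((1 - psi z ^ 2) ^ m) ^ 2 ∂cell a b) atTop (𝓝 0) := by
  have h : Tendsto (fun m : ℕ => ∫ z, ((1 - psi z ^ 2) ^ m) ^ 2 ∂cell a b) atTop
      (𝓝 (∫ _, (0 : ℝ) ∂cell a b)) := by
    refine tendsto_integral_of_dominated_convergence (fun _ => 1) ?_ (integrable_const _) ?_ ?_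
    · intro m
      exact Continuous.aestronglyMeasurable (by fun_prop)
    · intro m
      refine Eventually.of_forall fun z => ?_
      have h := one_sub_psi_sq_mem z
      rw [Real.norm_of_nonneg (sq_nonneg _)]
      exact pow_le_one₀ (pow_nonneg h.1 _) (pow_le_one₀ h.1 h.2)
    -- The half-open cell contains its right and top edges, where ψ = 0; they are null.
    · have hne : ∀ᵐ z ∂cell a b, z.1 ≠ (a : ℝ) + 1 ∧ z.2 ≠ (b : ℝ) + 1 := by
        unfold cell
        refine Filter.Eventually.and ?_ ?_
        · exact Measure.quasiMeasurePreserving_fst.ae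
            (ae_restrict_of_ae (Measure.ae_ne volume ((a : ℝ) + 1)))
        · exact Measure.quasiMeasurePreserving_snd.ae
            (ae_restrict_of_ae (Measure.ae_ne volume ((b : ℝ) + 1)))
      filter_upwards [ae_cell_mem a b, hne] with z hz hz'
      have hs : ∀ (k : ℤ) (t : ℝ), t ∈ Ioc (k : ℝ) (k + 1) → t ≠ k + 1 →
          Real.sin (Real.pi * t) ≠ 0 := by
        intro k t ht ht' h0
        obtain ⟨j, hj⟩ := Real.sin_eq_zero_iff.1 h0
        have : (j : ℝ) = t := by
          have := Real.pi_pos.ne'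
          field_simp at hj
          exact hj
        have h1 : (k : ℝ) < j := this ▸ ht.1
        have h2 : (j : ℝ) < k + 1 := this ▸ lt_of_le_of_ne ht.2 ht'
        have h1' : k < j := by exact_mod_cast h1
        have h2' : j < k + 1 := by exact_mod_cast h2
        omega
      have hp : psi z ≠ 0 := mul_ne_zero (hs a _ hz.1 hz'.1) (hs b _ hz.2 hz'.2)
      have h := one_sub_psi_sq_mem z
      have := (tendsto_pow_atTop_nhds_zero_of_lt_one h.1
        (by have := sq_pos_of_ne_zero hp; linarith)).pow 2
      simpa using this
  simpa using h

/-- Triangle inequality along a lattice path of i + j steps, up the column of index 0 and then to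
the right. -/
theorem norm_sub_origin_le {h : ℕ → ℕ → ℂ} {M : ℕ} {e : ℝ}
    (hr : ∀ i j, i + 1 < M → j < M → ‖h (i + 1) j - h i j‖ ≤ e)
    (hu : ∀ i j, i < M → j + 1 < M → ‖h i (j + 1) - h i j‖ ≤ e) :
    ∀ i j, i < M → j < M → ‖h i j - h 0 0‖ ≤ (i + j) * e := by
  intro i
  induction i with
  | zero =>
    intro j
    induction j with
    | zero => simp
    | succ j ih =>
      intro h0 hj
      have h1 := ih h0 (by omega)
      have h2 := hu 0 j h0 hj
      have h3 := norm_add_le (h 0 (j + 1) - h 0 j) (h 0 j - h 0 0)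
      rw [sub_add_sub_cancel] at h3
      push_cast at h1 ⊢
      linarith
  | succ i ih =>
    intro j hi hj
    have h1 := ih j (by omega) hj
    have h2 := hr i j hi hj
    have h3 := norm_add_le (h (i + 1) j - h i j) (h i j - h 0 0)
    rw [sub_add_sub_cancel] at h3
    push_cast at h1 ⊢
    linarith

/-- The sum over the cells of the square `[0, M]²`. -/
noncomputable def boxIntegral (M : ℕ) (g : ℝ × ℝ → ℝ) : ℝ :=
  ∑ i ∈ Finset.range M, ∑ j ∈ Finset.range M, ∫ z, g z ∂cell i j

theorem integral_cell_le_boxIntegral {M : ℕ} {g : ℝ × ℝ → ℝ} (hg : ∀ z, 0 ≤ g z) {i j : ℕ}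
    (hi : i < M) (hj : j < M) : ∫ z, g z ∂cell i j ≤ boxIntegral M g := by
  have h0 : ∀ i j : ℕ, 0 ≤ ∫ z, g z ∂cell i j := fun i j => integral_nonneg hg
  refine (Finset.single_le_sum (f := fun j : ℕ => ∫ z, g z ∂cell i j)
    (fun j _ => h0 i j) (Finset.mem_range.2 hj)).trans ?_
  exact Finset.single_le_sum (f := fun i : ℕ => ∑ j ∈ Finset.range M, ∫ z, g z ∂cell i j)
    (fun i _ => Finset.sum_nonneg fun j _ => h0 i j) (Finset.mem_range.2 hi)

theorem boxIntegral_nonneg {M : ℕ} {g : ℝ × ℝ → ℝ} (hg : ∀ z, 0 ≤ g z) : 0 ≤ boxIntegral M g :=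
  Finset.sum_nonneg fun _ _ => Finset.sum_nonneg fun _ _ => integral_nonneg hg

theorem energy_nonneg (Fx Fy : ℝ × ℝ → ℂ) (z : ℝ × ℝ) : 0 ≤ energy Fx Fy z := by
  unfold energy; positivity

/-- Edge averages in the box are close to one another when the defect is small. -/
theorem norm_hEdge_sub_sq_le {F Fx Fy Fxy : ℝ × ℝ → ℂ} (hF : HasPartials F Fx Fy Fxy)
    {M m : ℕ} {ε : ℝ}
    (hm : ∀ i j : ℕ, i < M → j < M → ∫ z, ((1 - psi z ^ 2) ^ m) ^ 2 ∂cell i j ≤ ε)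
    {i j : ℕ} (hi : i < M) (hj : j < M) :
    ‖hEdge F i j - hEdge F 0 0‖ ^ 2 ≤ 16 * M ^ 2 * (4 * ε * boxIntegral M (energy Fx Fy)
      + 8 * m ^ 2 * boxIntegral M fun z => ‖defect 0 F Fx Fy z‖ ^ 2) := by
  set Q := 4 * ε * boxIntegral M (energy Fx Fy)
      + 8 * m ^ 2 * boxIntegral M fun z => ‖defect 0 F Fx Fy z‖ ^ 2 with hQ
  have corner : ∀ i j : ℕ, i < M → j < M → ∀ x₀ x₁ y₀ y₁ : ℝ, Endpoints i x₀ x₁ →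
      Endpoints j y₀ y₁ → ‖hEdge F i y₁ - vEdge F x₁ j‖ ^ 2 ≤ Q := by
    intro i j hi hj x₀ x₁ y₀ y₁ hx hy
    have h := norm_sub_edge_sq_le hF m (a := i) (b := j) (by simpa using hx) (by simpa using hy)
    simp only [Int.cast_natCast] at h
    refine h.trans (add_le_add ?_ ?_)
    · have h0 : 0 ≤ ∫ z, ((1 - psi z ^ 2) ^ m) ^ 2 ∂cell i j :=
        integral_nonneg fun z => sq_nonneg _
      exact mul_le_mul (mul_le_mul_of_nonneg_left (hm i j hi hj) (by norm_num))
        (integral_cell_le_boxIntegral (energy_nonneg _ _) hi hj)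
        (integral_nonneg (energy_nonneg _ _)) (by linarith [hm i j hi hj])
    · refine mul_le_mul_of_nonneg_left ?_ (by positivity)
      simpa [defect] using integral_cell_le_boxIntegral
        (g := fun z => ‖defect 0 F Fx Fy z‖ ^ 2) (fun z => by positivity) hi hj
  have hQ0 : 0 ≤ Q := (sq_nonneg _).trans
    (corner i j hi hj _ _ _ _ (Or.inl ⟨rfl, rfl⟩) (Or.inl ⟨rfl, rfl⟩))
  have corner' : ∀ i j : ℕ, i < M → j < M → ∀ x₀ x₁ y₀ y₁ : ℝ, Endpoints i x₀ x₁ →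
      Endpoints j y₀ y₁ → ‖hEdge F i y₁ - vEdge F x₁ j‖ ≤ √Q :=
    fun i j hi hj x₀ x₁ y₀ y₁ hx hy => Real.le_sqrt_of_sq_le (corner i j hi hj x₀ x₁ y₀ y₁ hx hy)
  -- Each lattice step costs two corner comparisons, hence 2√Q; a path has at most 2M steps.
  have chain := norm_sub_origin_le (h := fun i j => hEdge F i j) (M := M) (e := 2 * √Q) ?_ ?_
    i j hi hj
  · simp only [Nat.cast_zero] at chain
    have h1 : ((i : ℝ) + j) * (2 * √Q) ≤ 4 * M * √Q := by
      have a1 : (i : ℝ) ≤ M := by exact_mod_cast hi.le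
      have a2 : (j : ℝ) ≤ M := by exact_mod_cast hj.le
      nlinarith [Real.sqrt_nonneg Q]
    calc _ ≤ (4 * M * √Q) ^ 2 := pow_le_pow_left₀ (norm_nonneg _) (chain.trans h1) 2
      _ = 16 * M ^ 2 * √Q ^ 2 := by ring
      _ = _ := by rw [Real.sq_sqrt hQ0]
  -- Bottom edges of horizontal neighbours are both compared with the vertical edge that the two
  -- cells share.
  · intro i j hi hj
    have h1 := corner' i j (by omega) hj _ _ _ _ (Or.inl ⟨rfl, rfl⟩) (Or.inr ⟨rfl, rfl⟩)
    have h2 := corner' (i + 1) j hi hj _ _ _ _ (Or.inr ⟨rfl, rfl⟩) (Or.inr ⟨rfl, rfl⟩)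
    have h3 := norm_sub_le (hEdge F ↑(i + 1) j - vEdge F ↑(i + 1) j)
      (hEdge F i j - vEdge F ((i : ℝ) + 1) j)
    push_cast at h2 h3 ⊢
    rw [sub_sub_sub_cancel_right] at h3
    linarith
  -- Bottom and top of one cell are both compared with its left edge; the top is the bottom edge of
  -- the cell above.
  · intro i j hi hj
    have h1 := corner' i j hi (by omega) _ _ _ _ (Or.inr ⟨rfl, rfl⟩) (Or.inr ⟨rfl, rfl⟩)
    have h2 := corner' i j hi (by omega) _ _ _ _ (Or.inr ⟨rfl, rfl⟩) (Or.inl ⟨rfl, rfl⟩)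
    have h3 := norm_sub_le (hEdge F i ((j : ℝ) + 1) - vEdge F i j)
      (hEdge F i j - vEdge F i j)
    push_cast
    rw [sub_sub_sub_cancel_right] at h3
    linarith

/-- A Poincaré inequality on the box, at the scale of one cell, for approximate eigenfunctions of
`∇^⊥ψ · ∇`. -/
theorem exists_boxIntegral_sub_sq_le (M : ℕ) (κ : ℝ) {η : ℝ} (hη : 0 < η) :
    ∃ B : ℝ, ∀ F Fx Fy Fxy : ℝ × ℝ → ℂ, HasPartials F Fx Fy Fxy →
      ∃ c : ℂ, boxIntegral M (fun z => ‖F z - c‖ ^ 2)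
        ≤ (4 + η) * boxIntegral M (energy Fx Fy)
          + B * boxIntegral M fun z => ‖defect κ F Fx Fy z‖ ^ 2 := by
  by_cases hκ : κ = 0
  · subst hκ
    -- Summing 2 · 16M² · 4ε over M² cells gives 128M⁴ε, which this threshold keeps below η. The
    -- resulting m, and so B, does not depend on F.
    obtain ⟨m, hm⟩ : ∃ m : ℕ, ∀ i ∈ Finset.range M, ∀ j ∈ Finset.range M,
        ∫ z, ((1 - psi z ^ 2) ^ m) ^ 2 ∂cell i j ≤ η / (128 * M ^ 4 + 1) := by
      have : ∀ᶠ m : ℕ in atTop, ∀ i ∈ Finset.range M, ∀ j ∈ Finset.range M,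
          ∫ z, ((1 - psi z ^ 2) ^ m) ^ 2 ∂cell i j ≤ η / (128 * M ^ 4 + 1) := by
        refine (Filter.eventually_all_finset _).2 fun i _ =>
          (Filter.eventually_all_finset _).2 fun j _ => ?_
        have h := tendsto_integral_cutoff i j
        simp only [Int.cast_natCast] at h
        exact h.eventually (ge_mem_nhds (by positivity))
      exact this.exists
    refine ⟨256 * M ^ 4 * m ^ 2, fun F Fx Fy Fxy hF => ⟨hEdge F 0 0, ?_⟩⟩
    have cF := hF.cont
    set D := boxIntegral M (energy Fx Fy) with hD
    set R := boxIntegral M fun z => ‖defect 0 F Fx Fy z‖ ^ 2 with hR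
    have hD0 : 0 ≤ D := boxIntegral_nonneg (energy_nonneg _ _)
    have hcell : ∀ i ∈ Finset.range M, ∀ j ∈ Finset.range M,
        ∫ z, ‖F z - hEdge F 0 0‖ ^ 2 ∂cell i j ≤ 4 * (∫ z, energy Fx Fy z ∂cell i j)
          + 2 * (16 * M ^ 2 * (4 * (η / (128 * M ^ 4 + 1)) * D + 8 * m ^ 2 * R)) := by
      intro i hi j hj
      have h1 := integral_sub_hEdge_sq_le hF i j
      have h2 := norm_hEdge_sub_sq_le hF
        (fun i j hi hj => hm i (Finset.mem_range.2 hi) j (Finset.mem_range.2 hj))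
        (Finset.mem_range.1 hi) (Finset.mem_range.1 hj)
      -- Splitting the square doubles the Poincaré constant 2, whence the 4 in the statement.
      have h3 : ∫ z, ‖F z - hEdge F 0 0‖ ^ 2 ∂cell i j
          ≤ ∫ z, (2 * ‖F z - hEdge F i j‖ ^ 2 + 2 * ‖hEdge F i j - hEdge F 0 0‖ ^ 2)
            ∂cell i j := by
        refine integral_mono (integrable_cell (by fun_prop) _ _)
          (integrable_cell (by fun_prop) _ _) fun z => ?_
        have t := norm_add_le (F z - hEdge F i j) (hEdge F i j - hEdge F 0 0)
        rw [sub_add_sub_cancel] at t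
        simp only
        nlinarith [norm_nonneg (F z - hEdge F 0 0),
          sq_nonneg (‖F z - hEdge F i j‖ - ‖hEdge F i j - hEdge F 0 0‖)]
      rw [integral_add (integrable_cell (by fun_prop) _ _) (integrable_const _),
        integral_const_mul] at h3
      simp only [integral_const, probReal_univ, one_smul] at h3
      linarith
    have hsum : boxIntegral M (fun z => ‖F z - hEdge F 0 0‖ ^ 2) ≤ 4 * D + M * (M *
        (2 * (16 * M ^ 2 * (4 * (η / (128 * M ^ 4 + 1)) * D + 8 * m ^ 2 * R)))) := by
      refine (Finset.sum_le_sum fun i hi => Finset.sum_le_sum fun j hj =>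
        hcell i hi j hj).trans (le_of_eq ?_)
      simp only [Finset.sum_add_distrib, Finset.sum_const, Finset.card_range, nsmul_eq_mul,
        ← Finset.mul_sum]
      rfl
    have hη' : 128 * (M : ℝ) ^ 4 * (η / (128 * M ^ 4 + 1)) ≤ η := by
      rw [mul_div_assoc', div_le_iff₀ (by positivity)]
      nlinarith
    have := mul_le_mul_of_nonneg_right hη' hD0
    linarith
  · refine ⟨(κ ^ 2)⁻¹, fun F Fx Fy Fxy hF => ⟨0, ?_⟩⟩
    have hD0 : 0 ≤ boxIntegral M (energy Fx Fy) := boxIntegral_nonneg (energy_nonneg _ _)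
    have hsum : boxIntegral M (fun z => ‖F z - 0‖ ^ 2) ≤ 2 * boxIntegral M (energy Fx Fy)
        + (κ ^ 2)⁻¹ * boxIntegral M fun z => ‖defect κ F Fx Fy z‖ ^ 2 := by
      simp only [sub_zero, boxIntegral, Finset.mul_sum, ← Finset.sum_add_distrib]
      refine Finset.sum_le_sum fun i _ => Finset.sum_le_sum fun j _ => ?_
      simpa only [Int.cast_natCast] using integral_sq_le_of_ne_zero hF hκ i j
    nlinarith

/-! ### From the box to the torus -/

instance isProbabilityMeasure_circle :
    IsProbabilityMeasure (volume : Measure UnitAddCircle) :=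
  ⟨by rw [AddCircle.measure_univ, ENNReal.ofReal_one]⟩

instance isProbabilityMeasure_torus : IsProbabilityMeasure (volume : Measure T2) := by
  rw [volume_pi]; infer_instance

/-- The corner (a, b) of the fundamental square is left free to accommodate the half-cell shift of
`toTorus`. -/
theorem integral_torus {g : T2 → ℝ} (hg : Continuous g) (a b : ℝ) :
    ∫ p, g p = ∫ x in a..a + 1, ∫ y in b..b + 1, g ![(x : UnitAddCircle), (y : UnitAddCircle)] := by
  have h := ((volume_preserving_finTwoArrow UnitAddCircle).symm _).integral_comp'
    (g := fun p : T2 => g p)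
  have hc : Continuous fun q : UnitAddCircle × UnitAddCircle => g ![q.1, q.2] := by fun_prop
  rw [← h, AddCircle.intervalIntegral_preimage 1 a fun u : UnitAddCircle =>
    ∫ y in b..b + 1, g ![u, (y : UnitAddCircle)]]
  rw [Measure.volume_eq_prod]
  refine (integral_prod (fun q : UnitAddCircle × UnitAddCircle => g ![q.1, q.2])
    (hc.integrable_of_hasCompactSupport (HasCompactSupport.of_compactSpace _))).trans ?_
  refine integral_congr_ae (Eventually.of_forall fun u => ?_)
  exact (AddCircle.intervalIntegral_preimage 1 b fun w : UnitAddCircle => g ![u, w]).symm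

/-- The projection to the torus of the box `[0, M]²`, rescaled and shifted by half a cell. -/
noncomputable def toTorus (M : ℕ) (z : ℝ × ℝ) : T2 :=
  ![((z.1 / M : ℝ) : UnitAddCircle), ((z.2 / M - 1 / (2 * M) : ℝ) : UnitAddCircle)]

@[fun_prop] theorem continuous_toTorus (M : ℕ) : Continuous (toTorus M) := by
  unfold toTorus
  refine continuous_pi fun i => ?_
  fin_cases i
  · exact (AddCircle.continuous_mk' 1).comp (by fun_prop)
  · exact (AddCircle.continuous_mk' 1).comp (by fun_prop)

/-- The cells tile the box, which `toTorus` shrinks to a fundamental square; M² is the Jacobian. -/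
theorem boxIntegral_toTorus {M : ℕ} (hM : 0 < M) {g : T2 → ℝ} (hg : Continuous g) :
    boxIntegral M (fun z => g (toTorus M z)) = (M : ℝ) ^ 2 * ∫ p, g p := by
  have hM' : (M : ℝ) ≠ 0 := by positivity
  have hc : Continuous fun z => g (toTorus M z) := by fun_prop
  have hy : ∀ x : ℝ, ∑ j ∈ Finset.range M, ∫ y in (j : ℝ)..(j : ℝ) + 1, g (toTorus M (x, y))
      = ∫ y in (0 : ℝ)..M, g (toTorus M (x, y)) := by
    intro x
    have := intervalIntegral.sum_integral_adjacent_intervals (a := fun k : ℕ => (k : ℝ)) (n := M)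
      (f := fun y => g (toTorus M (x, y))) (μ := volume)
      (fun k _ => Continuous.intervalIntegrable (by fun_prop) _ _)
    simpa using this
  have hx : ∑ i ∈ Finset.range M, ∫ x in (i : ℝ)..(i : ℝ) + 1,
        ∫ y in (0 : ℝ)..M, g (toTorus M (x, y))
      = ∫ x in (0 : ℝ)..M, ∫ y in (0 : ℝ)..M, g (toTorus M (x, y)) := by
    have := intervalIntegral.sum_integral_adjacent_intervals (a := fun k : ℕ => (k : ℝ)) (n := M)
      (f := fun x => ∫ y in (0 : ℝ)..M, g (toTorus M (x, y))) (μ := volume)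
      (fun k _ => Continuous.intervalIntegrable (by fun_prop) _ _)
    simpa using this
  have e1 : boxIntegral M (fun z => g (toTorus M z))
      = ∫ x in (0 : ℝ)..M, ∫ y in (0 : ℝ)..M, g (toTorus M (x, y)) := by
    rw [← hx, boxIntegral]
    refine Finset.sum_congr rfl fun i _ => ?_
    simp only [integral_cell hc, ← hy]
    rw [intervalIntegral.integral_finsetSum]
    exact fun j _ => Continuous.intervalIntegrable (by fun_prop) _ _
  have e2 : ∀ x : ℝ, ∫ y in (0 : ℝ)..M, g (toTorus M (x, y))
      = M * ∫ y in (-(1 / (2 * M)) : ℝ)..(-(1 / (2 * M))) + 1,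
        g ![((x / M : ℝ) : UnitAddCircle), (y : UnitAddCircle)] := by
    intro x
    have := intervalIntegral.integral_comp_div_sub (a := 0) (b := (M : ℝ))
      (fun y : ℝ => g ![((x / M : ℝ) : UnitAddCircle), (y : UnitAddCircle)]) hM' (1 / (2 * M))
    rw [zero_div, zero_sub, div_self hM', smul_eq_mul, sub_eq_neg_add] at this
    exact this
  rw [e1, integral_torus hg 0 (-(1 / (2 * M)))]
  simp only [e2]
  have := intervalIntegral.integral_comp_div (a := 0) (b := (M : ℝ))
    (fun x : ℝ => (M : ℝ) * ∫ y in (-(1 / (2 * M)) : ℝ)..(-(1 / (2 * M))) + 1,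
        g ![(x : UnitAddCircle), (y : UnitAddCircle)]) hM'
  rw [this, intervalIntegral.integral_const_mul, zero_div, div_self hM', zero_add, smul_eq_mul]
  ring

/-! ### Trigonometric polynomials and the flow in cell coordinates -/

/-- The trigonometric polynomial with coefficients `c` and frequencies in `S`. -/
noncomputable def trig (S : Finset (Fin 2 → ℤ)) (c : (Fin 2 → ℤ) → ℂ) (p : T2) : ℂ :=
  ∑ k ∈ S, c k * UnitAddTorus.mFourier k p

/-- The coefficients of the `i`-th partial derivative. -/
noncomputable def diffCoeff (i : Fin 2) (c : (Fin 2 → ℤ) → ℂ) (k : Fin 2 → ℤ) : ℂ :=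
  2 * Real.pi * Complex.I * k i * c k

@[fun_prop] theorem continuous_trig (S : Finset (Fin 2 → ℤ)) (c : (Fin 2 → ℤ) → ℂ) :
    Continuous (trig S c) := by
  unfold trig; fun_prop

theorem mFourier_two (k : Fin 2 → ℤ) (u w : UnitAddCircle) :
    UnitAddTorus.mFourier k ![u, w] = fourier (k 0) u * fourier (k 1) w := by
  simp [UnitAddTorus.mFourier, Fin.prod_univ_two]

theorem hasDerivAt_mFourier_fst (k : Fin 2 → ℤ) (x : ℝ) (w : UnitAddCircle) :
    HasDerivAt (fun s : ℝ => UnitAddTorus.mFourier k ![(s : UnitAddCircle), w])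
      (2 * Real.pi * Complex.I * k 0 * UnitAddTorus.mFourier k ![(x : UnitAddCircle), w]) x := by
  simp only [mFourier_two]
  refine ((hasDerivAt_fourier 1 (k 0) x).mul_const (fourier (k 1) w)).congr_deriv ?_
  simp; ring

theorem hasDerivAt_mFourier_snd (k : Fin 2 → ℤ) (u : UnitAddCircle) (y : ℝ) :
    HasDerivAt (fun t : ℝ => UnitAddTorus.mFourier k ![u, (t : UnitAddCircle)])
      (2 * Real.pi * Complex.I * k 1 * UnitAddTorus.mFourier k ![u, (y : UnitAddCircle)]) y := by
  simp only [mFourier_two]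
  refine ((hasDerivAt_fourier 1 (k 1) y).const_mul (fourier (k 0) u)).congr_deriv ?_
  simp; ring

theorem hasDerivAt_trig_fst (S : Finset (Fin 2 → ℤ)) (c : (Fin 2 → ℤ) → ℂ) (x : ℝ)
    (w : UnitAddCircle) :
    HasDerivAt (fun s : ℝ => trig S c ![(s : UnitAddCircle), w])
      (trig S (diffCoeff 0 c) ![(x : UnitAddCircle), w]) x := by
  refine (HasDerivAt.fun_sum fun k _ => (hasDerivAt_mFourier_fst k x w).const_mul (c k)).congr_deriv
    ?_
  exact Finset.sum_congr rfl fun k _ => by rw [diffCoeff]; ring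

theorem hasDerivAt_trig_snd (S : Finset (Fin 2 → ℤ)) (c : (Fin 2 → ℤ) → ℂ) (u : UnitAddCircle)
    (y : ℝ) :
    HasDerivAt (fun t : ℝ => trig S c ![u, (t : UnitAddCircle)])
      (trig S (diffCoeff 1 c) ![u, (y : UnitAddCircle)]) y := by
  refine (HasDerivAt.fun_sum fun k _ => (hasDerivAt_mFourier_snd k u y).const_mul (c k)).congr_deriv
    ?_
  exact Finset.sum_congr rfl fun k _ => by rw [diffCoeff]; ring

theorem diffCoeff_comm (c : (Fin 2 → ℤ) → ℂ) :
    diffCoeff 0 (diffCoeff 1 c) = diffCoeff 1 (diffCoeff 0 c) := by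
  funext k; simp only [diffCoeff]; ring

theorem hasDerivAt_trig_toTorus_fst (M : ℕ) (S : Finset (Fin 2 → ℤ)) (c : (Fin 2 → ℤ) → ℂ)
    (x y : ℝ) :
    HasDerivAt (fun s : ℝ => trig S c (toTorus M (s, y)))
      ((M : ℂ)⁻¹ * trig S (diffCoeff 0 c) (toTorus M (x, y))) x := by
  have h : HasDerivAt (fun s : ℝ => s / M) ((M : ℝ)⁻¹) x := by
    simpa using (hasDerivAt_id x).div_const (M : ℝ)
  have := HasDerivAt.scomp x (hasDerivAt_trig_fst S c (x / M)
    ((y / M - 1 / (2 * M) : ℝ) : UnitAddCircle)) h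
  rw [Complex.real_smul, Complex.ofReal_inv, Complex.ofReal_natCast] at this
  exact this

theorem hasDerivAt_trig_toTorus_snd (M : ℕ) (S : Finset (Fin 2 → ℤ)) (c : (Fin 2 → ℤ) → ℂ)
    (x y : ℝ) :
    HasDerivAt (fun t : ℝ => trig S c (toTorus M (x, t)))
      ((M : ℂ)⁻¹ * trig S (diffCoeff 1 c) (toTorus M (x, y))) y := by
  have h : HasDerivAt (fun s : ℝ => s / M - 1 / (2 * M)) ((M : ℝ)⁻¹) y := by
    simpa using ((hasDerivAt_id y).div_const (M : ℝ)).sub_const (1 / (2 * M) : ℝ)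
  have := HasDerivAt.scomp y (hasDerivAt_trig_snd S c ((x / M : ℝ) : UnitAddCircle)
    (y / M - 1 / (2 * M))) h
  rw [Complex.real_smul, Complex.ofReal_inv, Complex.ofReal_natCast] at this
  exact this

theorem hasPartials_trig (M : ℕ) (S : Finset (Fin 2 → ℤ)) (c : (Fin 2 → ℤ) → ℂ) :
    HasPartials (fun z => trig S c (toTorus M z))
      (fun z => (M : ℂ)⁻¹ * trig S (diffCoeff 0 c) (toTorus M z))
      (fun z => (M : ℂ)⁻¹ * trig S (diffCoeff 1 c) (toTorus M z))
      (fun z => (M : ℂ)⁻¹ * ((M : ℂ)⁻¹ * trig S (diffCoeff 1 (diffCoeff 0 c)) (toTorus M z))) where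
  dx x y := hasDerivAt_trig_toTorus_fst M S c x y
  dy x y := hasDerivAt_trig_toTorus_snd M S c x y
  dxy x y := (hasDerivAt_trig_toTorus_snd M S _ x y).const_mul _
  dyx x y := by
    rw [← diffCoeff_comm]
    exact (hasDerivAt_trig_toTorus_fst M S _ x y).const_mul _
  cont := by fun_prop
  cont_x := by fun_prop
  cont_y := by fun_prop
  cont_xy := by fun_prop

theorem exists_coe_eq (p : T2) :
    ∃ x y : ℝ, p = ![(x : UnitAddCircle), (y : UnitAddCircle)] := by
  obtain ⟨x, hx⟩ := QuotientAddGroup.mk_surjective (p 0)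
  obtain ⟨y, hy⟩ := QuotientAddGroup.mk_surjective (p 1)
  refine ⟨x, y, funext fun i => ?_⟩
  fin_cases i
  · exact hx.symm
  · exact hy.symm

theorem coe_add_single_zero (x y t : ℝ) :
    (![(x : UnitAddCircle), (y : UnitAddCircle)] : T2) + Pi.single 0 (t : UnitAddCircle)
      = ![((x + t : ℝ) : UnitAddCircle), (y : UnitAddCircle)] := by
  funext i; fin_cases i <;> simp

theorem coe_add_single_one (x y t : ℝ) :
    (![(x : UnitAddCircle), (y : UnitAddCircle)] : T2) + Pi.single 1 (t : UnitAddCircle)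
      = ![(x : UnitAddCircle), ((y + t : ℝ) : UnitAddCircle)] := by
  funext i; fin_cases i <;> simp

theorem partialDeriv_zero_coe {E : Type*} [NormedAddCommGroup E] [NormedSpace ℝ E] {f : T2 → E}
    {f' : E} {x y : ℝ}
    (h : HasDerivAt (fun s : ℝ => f ![(s : UnitAddCircle), (y : UnitAddCircle)]) f' x) :
    partialDeriv 0 f ![(x : UnitAddCircle), (y : UnitAddCircle)] = f' := by
  simp only [partialDeriv, coe_add_single_zero]
  refine HasDerivAt.deriv ?_
  have := HasDerivAt.comp_const_add x 0 (f := fun s : ℝ =>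
    f ![(s : UnitAddCircle), (y : UnitAddCircle)]) (f' := f') (by simpa using h)
  exact this

theorem partialDeriv_one_coe {E : Type*} [NormedAddCommGroup E] [NormedSpace ℝ E] {f : T2 → E}
    {f' : E} {x y : ℝ}
    (h : HasDerivAt (fun t : ℝ => f ![(x : UnitAddCircle), (t : UnitAddCircle)]) f' y) :
    partialDeriv 1 f ![(x : UnitAddCircle), (y : UnitAddCircle)] = f' := by
  simp only [partialDeriv, coe_add_single_one]
  refine HasDerivAt.deriv ?_
  have := HasDerivAt.comp_const_add y 0 (f := fun t : ℝ =>
    f ![(x : UnitAddCircle), (t : UnitAddCircle)]) (f' := f') (by simpa using h)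
  exact this

theorem stream_coe (n : ℕ) (x y : ℝ) :
    stream n ![(x : UnitAddCircle), (y : UnitAddCircle)]
      = Real.sin (2 * Real.pi * n * x) * Real.cos (2 * Real.pi * n * y) := by
  simp [stream, Function.Periodic.lift_coe]

theorem cellularFlow_coe_zero (n : ℕ) (x y : ℝ) :
    cellularFlow n ![(x : UnitAddCircle), (y : UnitAddCircle)] 0
      = 2 * Real.pi * n * (Real.sin (2 * Real.pi * n * x) * Real.sin (2 * Real.pi * n * y)) := by
  have h : HasDerivAt (fun t : ℝ => stream n ![(x : UnitAddCircle), (t : UnitAddCircle)])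
      (-(2 * Real.pi * n * (Real.sin (2 * Real.pi * n * x) * Real.sin (2 * Real.pi * n * y)))) y := by
    simp only [stream_coe]
    have := ((hasDerivAt_id y).const_mul (2 * Real.pi * n)).cos.const_mul
      (Real.sin (2 * Real.pi * n * x))
    refine this.congr_deriv ?_
    simp only [id]; ring
  simp [cellularFlow, gradPerp, partialDeriv_one_coe h]

theorem cellularFlow_coe_one (n : ℕ) (x y : ℝ) :
    cellularFlow n ![(x : UnitAddCircle), (y : UnitAddCircle)] 1
      = 2 * Real.pi * n * (Real.cos (2 * Real.pi * n * x) * Real.cos (2 * Real.pi * n * y)) := by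
  have h : HasDerivAt (fun s : ℝ => stream n ![(s : UnitAddCircle), (y : UnitAddCircle)])
      (2 * Real.pi * n * (Real.cos (2 * Real.pi * n * x) * Real.cos (2 * Real.pi * n * y))) x := by
    simp only [stream_coe]
    have := ((hasDerivAt_id x).const_mul (2 * Real.pi * n)).sin.mul_const
      (Real.cos (2 * Real.pi * n * y))
    refine this.congr_deriv ?_
    simp only [id]; ring
  simp [cellularFlow, gradPerp, partialDeriv_zero_coe h]

theorem continuous_periodic_lift {f : ℝ → ℝ} (hf : Function.Periodic f 1) (hc : Continuous f) :
    Continuous (hf.lift : UnitAddCircle → ℝ) :=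
  continuous_coinduced_dom.2 hc

theorem continuous_cellularFlow (n : ℕ) (i : Fin 2) : Continuous fun p => cellularFlow n p i := by
  have cs : Continuous ((periodic_sin n).lift : UnitAddCircle → ℝ) :=
    continuous_periodic_lift _ (by fun_prop)
  have cc : Continuous ((periodic_cos n).lift : UnitAddCircle → ℝ) :=
    continuous_periodic_lift _ (by fun_prop)
  fin_cases i
  · have : (fun p => cellularFlow n p 0) = fun p : T2 =>
        2 * Real.pi * n * ((periodic_sin n).lift (p 0) * (periodic_sin n).lift (p 1)) := by
      funext p
      obtain ⟨x, y, rfl⟩ := exists_coe_eq p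
      rw [cellularFlow_coe_zero]
      simp [Function.Periodic.lift_coe]
    simp only [Fin.zero_eta, this]
    fun_prop
  · have : (fun p => cellularFlow n p 1) = fun p : T2 =>
        2 * Real.pi * n * ((periodic_cos n).lift (p 0) * (periodic_cos n).lift (p 1)) := by
      funext p
      obtain ⟨x, y, rfl⟩ := exists_coe_eq p
      rw [cellularFlow_coe_one]
      simp [Function.Periodic.lift_coe]
    simp only [Fin.mk_one, this]
    fun_prop

/-- The shift turns the cosine into a sine, so Ψ_n ∘ `toTorus` is ψ; the factor 2n is the chain
rule. -/
theorem cellularFlow_toTorus {n : ℕ} (hn : 1 ≤ n) (z : ℝ × ℝ) :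
    cellularFlow n (toTorus (2 * n) z) 0 = -((2 * n : ℕ) : ℝ) * psiY z ∧
      cellularFlow n (toTorus (2 * n) z) 1 = ((2 * n : ℕ) : ℝ) * psiX z := by
  have hn' : (n : ℝ) ≠ 0 := by positivity
  have ex : 2 * Real.pi * n * (z.1 / (2 * n : ℕ)) = Real.pi * z.1 := by
    push_cast; field_simp
  have ey : 2 * Real.pi * n * (z.2 / (2 * n : ℕ) - 1 / (2 * (2 * n : ℕ)))
      = Real.pi * z.2 - Real.pi / 2 := by
    push_cast; field_simp
  rw [toTorus, cellularFlow_coe_zero, cellularFlow_coe_one, ex, ey, Real.sin_sub_pi_div_two,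
    Real.cos_sub_pi_div_two, psiX, psiY]
  push_cast
  exact ⟨by ring, by ring⟩

/-- The deviation of `φ`, with gradient `G`, from being an eigenfunction of `v_n · ∇` with
eigenvalue `iμ`. -/
noncomputable def torusDefect (n : ℕ) (μ : ℝ) (φ : T2 → ℂ) (G : T2 → Fin 2 → ℂ) (p : T2) : ℂ :=
  ∑ i, (cellularFlow n p i : ℂ) * G p i - Complex.I * (μ : ℂ) * φ p

/-- The gradient of a trigonometric polynomial. -/
noncomputable def trigGrad (S : Finset (Fin 2 → ℤ)) (c : (Fin 2 → ℤ) → ℂ) (p : T2) (i : Fin 2) : ℂ :=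
  trig S (diffCoeff i c) p

/-- The box inequality read on the torus: the n² is the Jacobian on the left, which the squared
gradient on the right absorbs. -/
theorem exists_integral_trig_sq_le {n : ℕ} (hn : 1 ≤ n) (μ : ℝ) {η : ℝ} (hη : 0 < η) :
    ∃ B : ℝ, ∀ (S : Finset (Fin 2 → ℤ)) (c : (Fin 2 → ℤ) → ℂ),
      4 * (n : ℝ) ^ 2 * ∫ p, ‖trig S c p‖ ^ 2
        ≤ (4 + η) * (∫ p, ∑ i, ‖trigGrad S c p i‖ ^ 2)
          + B * (∫ p, ‖torusDefect n μ (trig S c) (trigGrad S c) p‖ ^ 2)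
          + 4 * (n : ℝ) ^ 2 * ‖∫ p, trig S c p‖ ^ 2 := by
  have hM : 0 < 2 * n := by omega
  have hM' : (n : ℝ) ≠ 0 := by positivity
  have hMC : (n : ℂ) ≠ 0 := by exact_mod_cast hM'
  -- The operator v_n · ∇ carries one factor 2n from the velocity and one from the gradient, so μ is
  -- divided by (2n)².
  obtain ⟨B, hB⟩ := exists_boxIntegral_sub_sq_le (2 * n) (μ / (2 * n) ^ 2) hη
  refine ⟨B / (2 * n) ^ 2, fun S c => ?_⟩
  obtain ⟨w, hw⟩ := hB _ _ _ _ (hasPartials_trig (2 * n) S c)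
  have cv := continuous_cellularFlow n
  have e1 := boxIntegral_toTorus hM (g := fun p => ‖trig S c p - w‖ ^ 2) (by fun_prop)
  have e2 := boxIntegral_toTorus hM
    (g := fun p => (((2 * n : ℕ) : ℝ) ^ 2)⁻¹ * ∑ i, ‖trigGrad S c p i‖ ^ 2)
    (by unfold trigGrad; fun_prop)
  have e3 := boxIntegral_toTorus hM
    (g := fun p => (((2 * n : ℕ) : ℝ) ^ 4)⁻¹ * ‖torusDefect n μ (trig S c) (trigGrad S c) p‖ ^ 2)
    (by unfold torusDefect trigGrad; fun_prop)
  have d2 : (fun z => (((2 * n : ℕ) : ℝ) ^ 2)⁻¹ * ∑ i, ‖trigGrad S c (toTorus (2 * n) z) i‖ ^ 2)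
      = energy (fun z => ((2 * n : ℕ) : ℂ)⁻¹ * trig S (diffCoeff 0 c) (toTorus (2 * n) z))
        (fun z => ((2 * n : ℕ) : ℂ)⁻¹ * trig S (diffCoeff 1 c) (toTorus (2 * n) z)) := by
    funext z
    simp only [energy, trigGrad, Fin.sum_univ_two, norm_mul, norm_inv, Complex.norm_natCast,
      mul_pow, inv_pow]
    ring
  have d3 : (fun z => (((2 * n : ℕ) : ℝ) ^ 4)⁻¹
        * ‖torusDefect n μ (trig S c) (trigGrad S c) (toTorus (2 * n) z)‖ ^ 2)
      = fun z => ‖defect (μ / (2 * n) ^ 2) (fun z => trig S c (toTorus (2 * n) z))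
        (fun z => ((2 * n : ℕ) : ℂ)⁻¹ * trig S (diffCoeff 0 c) (toTorus (2 * n) z))
        (fun z => ((2 * n : ℕ) : ℂ)⁻¹ * trig S (diffCoeff 1 c) (toTorus (2 * n) z)) z‖ ^ 2 := by
    funext z
    have : torusDefect n μ (trig S c) (trigGrad S c) (toTorus (2 * n) z)
        = ((2 * n : ℕ) : ℂ) ^ 2 * defect (μ / (2 * n) ^ 2)
        (fun z => trig S c (toTorus (2 * n) z))
        (fun z => ((2 * n : ℕ) : ℂ)⁻¹ * trig S (diffCoeff 0 c) (toTorus (2 * n) z))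
        (fun z => ((2 * n : ℕ) : ℂ)⁻¹ * trig S (diffCoeff 1 c) (toTorus (2 * n) z)) z := by
      obtain ⟨h0, h1⟩ := cellularFlow_toTorus hn z
      simp only [torusDefect, defect, trigGrad, Fin.sum_univ_two, h0, h1]
      push_cast
      field_simp
      ring
    rw [this, norm_mul, norm_pow, Complex.norm_natCast, mul_pow]
    have : ((2 * n : ℕ) : ℝ) ≠ 0 := by positivity
    field_simp
  rw [d2] at e2
  rw [d3] at e3
  rw [e1, e2, e3, integral_const_mul, integral_const_mul] at hw
  -- The constant w is unknown, but the deviation from any constant is at least the variance,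
  -- leaving only the mean of the polynomial.
  have hv := integral_norm_sq_le (P := (volume : Measure T2)) (F := trig S c)
    ((continuous_trig S c).integrable_of_hasCompactSupport (HasCompactSupport.of_compactSpace _))
    (Continuous.integrable_of_hasCompactSupport (by fun_prop)
      (HasCompactSupport.of_compactSpace _)) w
  have h2 := mul_le_mul_of_nonneg_left hv (show 0 ≤ 4 * (n : ℝ) ^ 2 by positivity)
  push_cast at hw
  have e4 : (4 + η) * ((2 * (n : ℝ)) ^ 2 * (((2 * (n : ℝ)) ^ 2)⁻¹ *
      ∫ p, ∑ i, ‖trigGrad S c p i‖ ^ 2)) = (4 + η) * ∫ p, ∑ i, ‖trigGrad S c p i‖ ^ 2 := by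
    field_simp
  have e5 : B * ((2 * (n : ℝ)) ^ 2 * (((2 * (n : ℝ)) ^ 4)⁻¹ *
      ∫ p, ‖torusDefect n μ (trig S c) (trigGrad S c) p‖ ^ 2))
      = B / (2 * n) ^ 2 * ∫ p, ‖torusDefect n μ (trig S c) (trigGrad S c) p‖ ^ 2 := by
    field_simp
  rw [e4, e5] at hw
  linarith

/-! ### Fourier approximation in L² -/

theorem norm_toLp_sq {α : Type*} [MeasurableSpace α] {ν : Measure α} {g : α → ℂ}
    (hg : MemLp g 2 ν) : ‖hg.toLp g‖ ^ 2 = ∫ p, ‖g p‖ ^ 2 ∂ν := by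
  have h := inner_self_eq_norm_sq (𝕜 := ℂ) (hg.toLp g)
  rw [← h, L2.inner_def, ← integral_re (L2.integrable_inner _ _)]
  refine integral_congr_ae ?_
  filter_upwards [hg.coeFn_toLp] with p hp
  rw [hp, inner_self_eq_norm_sq]

theorem volume_torus_eq :
    (volume : Measure T2) = Measure.pi fun _ : Fin 2 => AddCircle.haarAddCircle := by
  rw [volume_pi, AddCircle.volume_eq_smul_haarAddCircle, ENNReal.ofReal_one, one_smul]

/-- The Fourier coefficients of a function on the torus. -/
noncomputable def coeff (g : T2 → ℂ) (k : Fin 2 → ℤ) : ℂ :=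
  ∫ p, g p * UnitAddTorus.mFourier (-k) p

theorem memLp_of_continuous {g : T2 → ℂ} (hg : Continuous g) (ν : Measure T2)
    [IsFiniteMeasure ν] : MemLp g 2 ν :=
  MemLp.of_bound hg.aestronglyMeasurable ‖(⟨g, hg⟩ : C(T2, ℂ))‖
    (Eventually.of_forall fun p => ContinuousMap.norm_coe_le_norm ⟨g, hg⟩ p)

theorem toLp_trig (ν : Measure T2) [IsFiniteMeasure ν] (S : Finset (Fin 2 → ℤ))
    (c : (Fin 2 → ℤ) → ℂ) :
    (memLp_of_continuous (continuous_trig S c) ν).toLp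
      = ∑ k ∈ S, c k • ContinuousMap.toLp (E := ℂ) 2 ν ℂ (UnitAddTorus.mFourier k) := by
  simp only [← map_smul, ← map_sum]
  refine Lp.ext ?_
  filter_upwards [(memLp_of_continuous (continuous_trig S c) ν).coeFn_toLp,
    ContinuousMap.coeFn_toLp (p := 2) (𝕜 := ℂ) ν (∑ k ∈ S, c k • UnitAddTorus.mFourier k)]
    with p h1 h2
  rw [h1, h2]
  simp [trig]

/-- The measure is a variable tied by an equation, so that `subst` passes to product Haar measure
without rewriting inside the type of `toLp`. -/
theorem tendsto_toLp_trig {g : T2 → ℂ} {ν : Measure T2} [IsFiniteMeasure ν]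
    (hν : ν = Measure.pi fun _ : Fin 2 => AddCircle.haarAddCircle) (hg : MemLp g 2 ν) :
    Tendsto (fun S => (memLp_of_continuous
      (continuous_trig S fun k => ∫ p, g p * UnitAddTorus.mFourier (-k) p ∂ν) ν).toLp)
      atTop (𝓝 (hg.toLp g)) := by
  subst hν
  have h := UnitAddTorus.hasSum_mFourier_series_L2 (d := Fin 2) (hg.toLp g)
  refine Tendsto.congr (fun S => ?_) h
  rw [toLp_trig]
  refine Finset.sum_congr rfl fun k _ => ?_
  refine congrArg (· • ContinuousMap.toLp (E := ℂ) 2 _ ℂ (UnitAddTorus.mFourier k)) ?_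
  refine integral_congr_ae (α := T2) (G := ℂ) ?_
  filter_upwards [hg.coeFn_toLp] with p hp
  rw [smul_eq_mul, hp, mul_comm]

theorem tendsto_integral_trig_sub {g : T2 → ℂ} (hg : MemLp g 2 volume) :
    Tendsto (fun S => ∫ p, ‖trig S (coeff g) p - g p‖ ^ 2) atTop (𝓝 0) := by
  have h := (((tendsto_toLp_trig volume_torus_eq hg).sub_const (hg.toLp g)).norm).pow 2
  rw [sub_self, norm_zero, zero_pow two_ne_zero] at h
  refine h.congr fun S => ?_
  rw [← MemLp.toLp_sub, norm_toLp_sq]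
  rfl

theorem tendsto_integral_trig {g : T2 → ℂ} (hg : MemLp g 2 volume) :
    Tendsto (fun S => ∫ p, ‖trig S (coeff g) p‖ ^ 2) atTop (𝓝 (∫ p, ‖g p‖ ^ 2)) := by
  have h := ((tendsto_toLp_trig volume_torus_eq hg).norm).pow 2
  rw [norm_toLp_sq] at h
  refine h.congr fun S => ?_
  rw [norm_toLp_sq]
  rfl

theorem isSmooth_mFourier (k : Fin 2 → ℤ) : IsSmooth (UnitAddTorus.mFourier k) := by
  have : (fun x : Fin 2 → ℝ => UnitAddTorus.mFourier k fun i => (x i : UnitAddCircle))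
      = fun x => ∏ i, Complex.exp (2 * Real.pi * Complex.I * k i * (x i : ℝ)) := by
    funext x
    simp [UnitAddTorus.mFourier]
  rw [IsSmooth, this]
  refine contDiff_prod fun i _ => ContDiff.cexp ?_
  exact contDiff_const.mul (Complex.ofRealCLM.contDiff.comp (contDiff_apply ℝ ℝ i))

theorem partialDeriv_mFourier (i : Fin 2) (k : Fin 2 → ℤ) (p : T2) :
    partialDeriv i (UnitAddTorus.mFourier k) p
      = 2 * Real.pi * Complex.I * k i * UnitAddTorus.mFourier k p := by
  obtain ⟨x, y, rfl⟩ := exists_coe_eq p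
  fin_cases i
  · exact partialDeriv_zero_coe (hasDerivAt_mFourier_fst k x y)
  · exact partialDeriv_one_coe (hasDerivAt_mFourier_snd k x y)

/-- Test against the character of frequency -k. Consequently the gradient of a Fourier partial sum
of φ is the partial sum of G, and the sums converge in H¹. -/
theorem HasWeakGradient.coeff_eq {φ : T2 → ℂ} {G : T2 → Fin 2 → ℂ} (h : HasWeakGradient φ G)
    (i : Fin 2) : coeff (fun p => G p i) = diffCoeff i (coeff φ) := by
  funext k
  have := h i _ (isSmooth_mFourier (-k))
  simp only [partialDeriv_mFourier] at this
  rw [coeff, ← neg_eq_iff_eq_neg.2 this, diffCoeff, coeff, ← integral_const_mul, ← integral_neg]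
  refine integral_congr_ae (Eventually.of_forall fun p => ?_)
  simp only [Pi.neg_apply]
  push_cast
  ring

theorem abs_cellularFlow_le (n : ℕ) (p : T2) (i : Fin 2) :
    |cellularFlow n p i| ≤ 2 * Real.pi * n := by
  have aux : ∀ s t : ℝ, |s| ≤ 1 → |t| ≤ 1 → |2 * Real.pi * n * (s * t)| ≤ 2 * Real.pi * n := by
    intro s t hs ht
    rw [abs_mul, abs_of_nonneg (by positivity : 0 ≤ 2 * Real.pi * (n : ℝ)), abs_mul]
    exact mul_le_of_le_one_right (by positivity) (mul_le_one₀ hs (abs_nonneg _) ht)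
  obtain ⟨x, y, rfl⟩ := exists_coe_eq p
  fin_cases i
  · simp only [Fin.zero_eta, cellularFlow_coe_zero]
    exact aux _ _ (Real.abs_sin_le_one _) (Real.abs_sin_le_one _)
  · simp only [Fin.mk_one, cellularFlow_coe_one]
    exact aux _ _ (Real.abs_cos_le_one _) (Real.abs_cos_le_one _)

theorem norm_torusDefect_sq_le (n : ℕ) (μ : ℝ) (φ : T2 → ℂ) (G : T2 → Fin 2 → ℂ) (p : T2) :
    ‖torusDefect n μ φ G p‖ ^ 2
      ≤ 3 * ((2 * Real.pi * n) ^ 2 * (‖G p 0‖ ^ 2 + ‖G p 1‖ ^ 2) + μ ^ 2 * ‖φ p‖ ^ 2) := by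
  have h : ‖torusDefect n μ φ G p‖
      ≤ 2 * Real.pi * n * ‖G p 0‖ + 2 * Real.pi * n * ‖G p 1‖ + |μ| * ‖φ p‖ := by
    rw [torusDefect, Fin.sum_univ_two]
    refine (norm_sub_le _ _).trans (add_le_add ((norm_add_le _ _).trans (add_le_add ?_ ?_)) ?_)
    · rw [norm_mul, Complex.norm_real, Real.norm_eq_abs]
      exact mul_le_mul_of_nonneg_right (abs_cellularFlow_le n p 0) (norm_nonneg _)
    · rw [norm_mul, Complex.norm_real, Real.norm_eq_abs]
      exact mul_le_mul_of_nonneg_right (abs_cellularFlow_le n p 1) (norm_nonneg _)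
    · simp
  have h2 := pow_le_pow_left₀ (norm_nonneg _) h 2
  have e : μ ^ 2 * ‖φ p‖ ^ 2 = (|μ| * ‖φ p‖) ^ 2 := by rw [mul_pow, sq_abs]
  rw [e]
  set u := 2 * Real.pi * n * ‖G p 0‖
  set v := 2 * Real.pi * n * ‖G p 1‖
  set w := |μ| * ‖φ p‖
  have e2 : (2 * Real.pi * n) ^ 2 * (‖G p 0‖ ^ 2 + ‖G p 1‖ ^ 2) = u ^ 2 + v ^ 2 := by ring
  rw [e2]
  nlinarith [sq_nonneg (u - v), sq_nonneg (u - w), sq_nonneg (v - w)]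

/-- The defect is linear in (φ, G) and vanishes at the eigenfunction, so the defect of a partial sum
is that of the truncation error, which is small in L² because the flow is bounded. -/
theorem tendsto_integral_torusDefect {n : ℕ} {μ : ℝ} {φ : T2 → ℂ} {G : T2 → Fin 2 → ℂ}
    (hφ : MemLp φ 2 volume) (hG : ∀ i, MemLp (fun p => G p i) 2 volume)
    (hw : HasWeakGradient φ G) (h0 : ∀ᵐ p, torusDefect n μ φ G p = 0) :
    Tendsto (fun S => ∫ p, ‖torusDefect n μ (trig S (coeff φ)) (trigGrad S (coeff φ)) p‖ ^ 2)
      atTop (𝓝 0) := by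
  have t0 := tendsto_integral_trig_sub (hG 0)
  have t1 := tendsto_integral_trig_sub (hG 1)
  have t2 := tendsto_integral_trig_sub hφ
  rw [hw.coeff_eq] at t0 t1
  have hsq : ∀ (S : Finset (Fin 2 → ℤ)) (c : (Fin 2 → ℤ) → ℂ) {g : T2 → ℂ}, MemLp g 2 volume →
      Integrable fun p => ‖trig S c p - g p‖ ^ 2 := fun S c g hg =>
    ((memLp_of_continuous (continuous_trig S c) volume).sub hg).norm.integrable_sq
  have t := (((t0.add t1).const_mul ((2 * Real.pi * n) ^ 2)).add (t2.const_mul (μ ^ 2))).const_mul 3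
  simp only [add_zero, mul_zero] at t
  refine squeeze_zero (fun S => integral_nonneg fun p => by positivity) (fun S => ?_) t
  rw [← integral_add (hsq _ _ (hG 0)) (hsq _ _ (hG 1)), ← integral_const_mul,
    ← integral_const_mul, ← integral_add, ← integral_const_mul]
  rotate_left
  · exact ((hsq _ _ (hG 0)).add (hsq _ _ (hG 1))).const_mul _
  · exact (hsq _ _ hφ).const_mul _
  refine integral_mono_of_nonneg (Eventually.of_forall fun p => by positivity) ?_ ?_
  · exact ((((hsq _ _ (hG 0)).add (hsq _ _ (hG 1))).const_mul _).add
      ((hsq _ _ hφ).const_mul _)).const_mul _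
  · filter_upwards [h0] with p hp
    have e : torusDefect n μ (trig S (coeff φ)) (trigGrad S (coeff φ)) p
        = torusDefect n μ (fun p => trig S (coeff φ) p - φ p)
          (fun p i => trig S (diffCoeff i (coeff φ)) p - G p i) p := by
      rw [← sub_zero (torusDefect n μ (trig S (coeff φ)) (trigGrad S (coeff φ)) p), ← hp]
      simp only [torusDefect, trigGrad, Fin.sum_univ_two]
      ring
    rw [e]
    exact norm_torusDefect_sq_le n μ _ _ p

theorem tendsto_integral_trig_mean {φ : T2 → ℂ} (hφ : MemLp φ 2 volume) (h0 : ∫ p, φ p = 0) :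
    Tendsto (fun S => ‖∫ p, trig S (coeff φ) p‖ ^ 2) atTop (𝓝 0) := by
  refine squeeze_zero (fun S => by positivity) (fun S => ?_) (tendsto_integral_trig_sub hφ)
  have hm := (memLp_of_continuous (continuous_trig S (coeff φ)) volume).sub hφ
  have hi := (memLp_of_continuous (continuous_trig S (coeff φ)) volume).integrable one_le_two
  have e : ∫ p, trig S (coeff φ) p = ∫ p, (trig S (coeff φ) p - φ p) := by
    rw [integral_sub hi (hφ.integrable one_le_two), h0, sub_zero]
  rw [e]
  exact norm_integral_sq_le (hm.integrable one_le_two) hm.norm.integrable_sq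

/-! ### Passage to the limit -/

/-- The quantitative bound: the Dirichlet energy of a mean-zero eigenfunction is at least
`n²` times its squared norm. -/
theorem sq_mul_l2NormSq_le_dirichletEnergy {n : ℕ} (hn : 1 ≤ n) {φ : T2 → ℂ}
    (hφ : φ ∈ eigenfunctions (cellularFlow n)) :
    (n : ℝ) ^ 2 * l2NormSq φ ≤ dirichletEnergy φ := by
  obtain ⟨hH, hmean, μ, hμ⟩ := hφ
  obtain ⟨hG, hw⟩ : (∀ i, MemLp (fun p => weakGrad φ p i) 2 volume) ∧
      HasWeakGradient φ (weakGrad φ) := by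
    simp only [weakGrad, dif_pos hH]
    exact hH.2.choose_spec
  have h0 : ∀ᵐ p, torusDefect n μ φ (weakGrad φ) p = 0 := by
    filter_upwards [hμ] with p hp
    rw [torusDefect, hp, sub_self]
  have tD : Tendsto (fun S => ∫ p, ∑ i, ‖trigGrad S (coeff φ) p i‖ ^ 2) atTop
      (𝓝 (dirichletEnergy φ)) := by
    have e1 : ∀ S, ∫ p, ∑ i, ‖trigGrad S (coeff φ) p i‖ ^ 2
        = ∑ i, ∫ p, ‖trig S (coeff fun p => weakGrad φ p i) p‖ ^ 2 := by
      intro S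
      simp only [hw.coeff_eq]
      exact integral_finsetSum _ fun i _ =>
        (memLp_of_continuous (continuous_trig S _) volume).norm.integrable_sq
    simp only [e1]
    rw [dirichletEnergy, integral_finsetSum _ fun i _ => (hG i).norm.integrable_sq]
    exact tendsto_finsetSum _ fun i _ => tendsto_integral_trig (hG i)
  -- With η, hence B, fixed, the defect and mean terms vanish in the limit over S.
  have main : ∀ η : ℝ, 0 < η → 4 * (n : ℝ) ^ 2 * l2NormSq φ ≤ (4 + η) * dirichletEnergy φ := by
    intro η hη
    obtain ⟨B, hB⟩ := exists_integral_trig_sq_le hn μ hη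
    have tR := ((tD.const_mul (4 + η)).add
      ((tendsto_integral_torusDefect hH.1 hG hw h0).const_mul B)).add
      ((tendsto_integral_trig_mean hH.1 hmean).const_mul (4 * (n : ℝ) ^ 2))
    have := le_of_tendsto_of_tendsto' ((tendsto_integral_trig hH.1).const_mul (4 * (n : ℝ) ^ 2))
      tR fun S => hB S _
    simpa [l2NormSq] using this
  have lim : Tendsto (fun η : ℝ => (4 + η) * dirichletEnergy φ) (𝓝[>] 0)
      (𝓝 ((4 + 0) * dirichletEnergy φ)) :=
    ((tendsto_const_nhds.add tendsto_id).mul_const _).mono_left nhdsWithin_le_nhds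
  have := ge_of_tendsto lim (eventually_nhdsWithin_of_forall fun η hη => main η hη)
  linarith

theorem l2NormSq_pos {φ : T2 → ℂ} (hφ : MemLp φ 2 volume) (h0 : ¬φ =ᵐ[volume] 0) :
    0 < l2NormSq φ := by
  refine lt_of_le_of_ne (integral_nonneg fun p => by positivity) fun h => h0 ?_
  have := (integral_eq_zero_iff_of_nonneg (fun p => by positivity) hφ.norm.integrable_sq).1 h.symm
  filter_upwards [this] with p hp
  simpa using hp

end CellularFlow

theorem mainTheorem3 :
    ∃ δ : ℝ, 0 < δ ∧ ∀ n : ℕ, 1 ≤ n →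
      ENNReal.ofReal (δ * (n : ℝ) ^ 2) ≤ CellularFlow.rate (CellularFlow.cellularFlow n) ∧
      ∀ φ ∈ CellularFlow.eigenfunctions (CellularFlow.cellularFlow n),
        δ * (n : ℝ) ^ 2 * CellularFlow.l2NormSq φ ≤ CellularFlow.dirichletEnergy φ := by
  -- δ = 1 is the ratio of the 4n² cells to 4n², the limiting Poincaré constant 4 times n².
  refine ⟨1, one_pos, fun n hn => ⟨?_, fun φ hφ => ?_⟩⟩
  · refine le_iInf₂ fun φ hφ => ENNReal.ofReal_le_ofReal ?_
    rw [one_mul, le_div_iff₀ (CellularFlow.l2NormSq_pos hφ.1.1.1 hφ.2)]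
    exact CellularFlow.sq_mul_l2NormSq_le_dirichletEnergy hn hφ.1
  · rw [one_mul]
    exact CellularFlow.sq_mul_l2NormSq_le_dirichletEnergy hn hφ
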